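/- **Theorem.** Let $\mathbb T\subseteq\mathbb R$ be a time scale (a nonempty closed set) that is unbounded above, with forward jump $\sigma(t)=\inf\{s\in\mathbb T: s>t\}$ and graininess $\mu(t)=\sigma(t)-t$. Let $A,M:\mathbb T\to\mathbb R^{n\times n}$ be rd-continuous, and let $A$ be regressive, i.e. $I+\mu(t)A(t)$ is invertible for all $t\in\mathbb T$. For $\tau\in\mathbb T$ let $\Phi_A(\cdot,\tau)$ be the transition matrix of $x^\Delta=A(t)x$, i.e. the solution on $\mathbb T$ of $X^\Delta=A(t)X$, $X(\tau)=I$. Let $t_0\in\mathbb T$ and suppose that the improper delta integral $$P_0:=\int_{t_0}^{\infty}\Phi_A^T(s,t_0)\,M(s)\,\Phi_A(s,t_0)\,\Delta s$$ converges (as the limit of $\int_{t_0}^{b}$ for $b\to\infty$ in $\mathbb T$). Then the initial value problem for the time scale dynamic Lyapunov equation $$A^T(t)P(t)+P(t)A(t)+\mu(t)A^T(t)P(t)A(t)+(I+\mu(t)A^T(t))\,P^{\Delta}(t)\,(I+\mu(t)A(t))=-M(t),\qquad P(t_0)=P_0,$$ has a unique solution $P$ on $\mathbb T$. It is given for every $t\in\mathbb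 T$ by $$P(t)=(\Phi_A^T(t,t_0))^{-1}P_0(\Phi_A(t,t_0))^{-1}-(\Phi_A^T(t,t_0))^{-1}\Big[\int_{t_0}^{t}\Phi_A^T(s,t_0)M(s)\Phi_A(s,t_0)\,\Delta s\Big](\Phi_A(t,t_0))^{-1},$$ and this reduces to $$P(t)=\int_{t}^{\infty}\Phi_A^T(s,t)\,M(s)\,\Phi_A(s,t)\,\Delta s ,$$ where the improper integral converges for every $t\in\mathbb T$. If moreover $M(t)$ is symmetric positive definite for every $t\in\mathbb T$, then $P(t)$ is symmetric positive definite for every $t\in\mathbb T$, and $V(t,x)=x^TP(t)x$ is a Lyapunov function for $x^\Delta=A(t)x$: $V(t,x)\ge 0$ with equality if and only if $x=0$, and for every solution $x$ of $x^\Delta=A(t)x$ on $\mathbb T$ the function $t\mapsto V(t,x(t))$ is delta differentiable on $\mathbb T$ with delta derivative $\le 0$, and $<0$ at every $t\in\mathbb T$ with $x(t)\neq 0$. -/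

import Mathlib

open Filter Topology MeasureTheory
open scoped Matrix

noncomputable section

namespace TimeScale

/-- A time scale: a nonempty closed subset of the real line.  Functions on a time scale `T` are
represented by functions on `ℝ`; no definition below depends on their values outside `T`. -/
structure IsTimeScale (T : Set ℝ) : Prop where
  nonempty : T.Nonempty
  isClosed : IsClosed T

/-- Forward jump operator `σ(t) = inf {s ∈ T | s > t}` (used for `T` unbounded above, so the
set is never empty). -/
def sigma (T : Set ℝ) (t : ℝ) : ℝ := sInf {s | s ∈ T ∧ t < s}

/-- Graininess `μ(t) = σ(t) - t`. -/
def mu (T : Set ℝ) (t : ℝ) : ℝ := sigma T t - t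

/-- `d` is the delta (Hilger) derivative of `f : T → ℝ` at `t`: for every `ε > 0` the inequality
`|f(σ(t)) - f(s) - d (σ(t) - s)| ≤ ε |σ(t) - s|` holds for all `s ∈ T` in a neighbourhood
of `t`.  When `T` is unbounded above, `T^κ = T`, so this is meaningful at every `t ∈ T`. -/
def HasDeltaDerivAt (T : Set ℝ) (f : ℝ → ℝ) (d t : ℝ) : Prop :=
  ∀ ε : ℝ, 0 < ε → ∀ᶠ s in 𝓝[T] t,
    |f (sigma T t) - f s - d * (sigma T t - s)| ≤ ε * |sigma T t - s|

/-- Rd-continuity: continuity at the right-dense points, and finite left limits at the left-dense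
points (at a point that is not left-dense, or at `min T`, the filter `𝓝[T ∩ Set.Iio t] t` is
trivial and the second clause is void). -/
def RdContinuous (T : Set ℝ) (f : ℝ → ℝ) : Prop :=
  (∀ t ∈ T, sigma T t = t → ContinuousWithinAt f T t) ∧
  (∀ t ∈ T, ∃ l : ℝ, Tendsto f (𝓝[T ∩ Set.Iio t] t) (𝓝 l))

/-- The Lebesgue delta measure of `T` (unbounded above): Lebesgue measure on `T` plus an atom of
mass `μ(t)` at each right-scattered point `t ∈ T`.  Thus `[a, b)` has measure `b - a` for
`a ≤ b` in `T`. -/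
def deltaMeasure (T : Set ℝ) : Measure ℝ :=
  volume.restrict T +
    Measure.sum (fun t : {t : ℝ // t ∈ T ∧ t < sigma T t} =>
      ENNReal.ofReal (mu T t) • Measure.dirac (t : ℝ))

/-- The oriented delta integral `∫_a^b f(s) Δs`, for `a`, `b` in `T`; it is the integral over
`[a, b)` if `a ≤ b` and minus the integral over `[b, a)` if `b ≤ a`. -/
def deltaIntegral (T : Set ℝ) (f : ℝ → ℝ) (a b : ℝ) : ℝ :=
  (∫ s in Set.Ico a b, f s ∂(deltaMeasure T)) - ∫ s in Set.Ico b a, f s ∂(deltaMeasure T)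

/-! Vector and matrix versions, entry by entry. -/

variable {n : ℕ}

/-- Rd-continuity of a matrix function. -/
def MatRdContinuous (T : Set ℝ) (F : ℝ → Matrix (Fin n) (Fin n) ℝ) : Prop :=
  ∀ i j, RdContinuous T (fun s => F s i j)

/-- Delta derivative of a matrix function. -/
def MatHasDeltaDerivAt (T : Set ℝ) (F : ℝ → Matrix (Fin n) (Fin n) ℝ)
    (D : Matrix (Fin n) (Fin n) ℝ) (t : ℝ) : Prop :=
  ∀ i j, HasDeltaDerivAt T (fun s => F s i j) (D i j) t

/-- Delta derivative of a vector function. -/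
def VecHasDeltaDerivAt (T : Set ℝ) (x : ℝ → Fin n → ℝ) (d : Fin n → ℝ) (t : ℝ) : Prop :=
  ∀ i, HasDeltaDerivAt T (fun s => x s i) (d i) t

/-- Delta integral `∫_a^b F(s) Δs` of a matrix function. -/
def matDeltaIntegral (T : Set ℝ) (F : ℝ → Matrix (Fin n) (Fin n) ℝ) (a b : ℝ) :
    Matrix (Fin n) (Fin n) ℝ :=
  Matrix.of fun i j => deltaIntegral T (fun s => F s i j) a b

/-- The improper integral `∫_a^∞ F(s) Δs` converges and equals `L`: the integrals
`∫_a^b F(s) Δs` tend to `L` as `b → ∞` in `T`. -/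
def HasImproperDeltaIntegral (T : Set ℝ) (F : ℝ → Matrix (Fin n) (Fin n) ℝ) (a : ℝ)
    (L : Matrix (Fin n) (Fin n) ℝ) : Prop :=
  ∀ i j, Tendsto (fun b => matDeltaIntegral T F a b i j) (atTop ⊓ 𝓟 T) (𝓝 (L i j))

/-- `A` is regressive: `I + μ(t) A(t)` is invertible for all `t ∈ T`. -/
def IsRegressive (T : Set ℝ) (A : ℝ → Matrix (Fin n) (Fin n) ℝ) : Prop :=
  ∀ t ∈ T, IsUnit (1 + mu T t • A t)

/-- `X` solves the initial value problem `X^Δ(t) = A(t) X(t)` for `t ∈ T`, `X(τ) = I`. -/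
def SolvesMatrixIVP (T : Set ℝ) (A : ℝ → Matrix (Fin n) (Fin n) ℝ) (τ : ℝ)
    (X : ℝ → Matrix (Fin n) (Fin n) ℝ) : Prop :=
  X τ = 1 ∧ ∀ t ∈ T, MatHasDeltaDerivAt T X (A t * X t) t

/-- The transition matrix `Φ_A(t, τ)`: the value at `t` of the solution of
`X^Δ = A X`, `X(τ) = I`, on `T`. -/
def transitionMatrix (T : Set ℝ) (A : ℝ → Matrix (Fin n) (Fin n) ℝ) (t τ : ℝ) :
    Matrix (Fin n) (Fin n) ℝ :=
  (Classical.epsilon (SolvesMatrixIVP T A τ)) t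

/-- `P` satisfies the time scale dynamic Lyapunov equation
`Aᵀ P + P A + μ Aᵀ P A + (I + μ Aᵀ) P^Δ (I + μ A) = -M` on `T`. -/
def SolvesTSDLE (T : Set ℝ) (A M P : ℝ → Matrix (Fin n) (Fin n) ℝ) : Prop :=
  ∀ t ∈ T, ∃ D : Matrix (Fin n) (Fin n) ℝ, MatHasDeltaDerivAt T P D t ∧
    (A t)ᵀ * P t + P t * A t + mu T t • ((A t)ᵀ * P t * A t)
      + (1 + mu T t • (A t)ᵀ) * D * (1 + mu T t • A t) = -M t

/-- `x` is a solution of the linear system `x^Δ(t) = A(t) x(t)` on `T`. -/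
def SolvesLinear (T : Set ℝ) (A : ℝ → Matrix (Fin n) (Fin n) ℝ) (x : ℝ → Fin n → ℝ) : Prop :=
  ∀ t ∈ T, VecHasDeltaDerivAt T x (A t *ᵥ x t) t

/-- `V(t, x)` is a (time varying) time scale Lyapunov function for `x^Δ = A(t) x`:
`V(t, x) ≥ 0` with equality if and only if `x = 0`, and along every solution `x(t)` the function
`t ↦ V(t, x(t))` is delta differentiable with derivative `≤ 0`. -/
structure IsLyapunovFunction (T : Set ℝ) (A : ℝ → Matrix (Fin n) (Fin n) ℝ)
    (V : ℝ → (Fin n → ℝ) → ℝ) : Prop where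
  nonneg : ∀ t ∈ T, ∀ x, 0 ≤ V t x
  eq_zero_iff : ∀ t ∈ T, ∀ x, V t x = 0 ↔ x = 0
  deriv_nonpos : ∀ x, SolvesLinear T A x → ∀ t ∈ T,
    ∃ d : ℝ, HasDeltaDerivAt T (fun s => V s (x s)) d t ∧ d ≤ 0

end TimeScale

end

/-! Conjugation by a solution of the linear system turns the Lyapunov equation into plain
integration. If `X^Δ = A X`, then `X(σ(t)) = (I + μA) X(t)`, and the product rule gives `(Xᵀ P X)^Δ
= Xᵀ L X`, where `L` is the left hand side of the equation (`hasDeltaDerivAt_conj`). For invertible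
`X` the equation therefore says that `Xᵀ P X + ∫ Xᵀ M X` is constant (`SolvesTSDLE.conj_eq`). With
`X = Φ(·, t₀)` this is the explicit formula, hence existence and uniqueness on `T`.

Since `P₀` is the whole improper integral, `Φᵀ P Φ` tends to `0` at infinity. The cocycle identity
moves this limit to every base point `t`, and the conservation law started at `t` gives `P(t)` as an
improper integral. For positive definite `M`, the form `b ↦ xᵀ Φ(b,t)ᵀ P(b) Φ(b,t) x` decreases
strictly to `0`, so it is positive at `b = t`; along a solution `x(t)` the derivative of `xᵀ P x` is
`-xᵀ M x`.

The transition matrix rests on two devices. Delta integrals are Lebesgue integrals of `f ∘ floorPt`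
(`deltaMeasure_restrict`), which yields the fundamental theorem of calculus and a Picard series
running forward from a least point. Regressivity replaces backward solving: the adjoint equation
`Y^Δ = -Y A (I + μA)⁻¹` is also solved forward, and `Y X` is constant, which gives both
invertibility and uniqueness. Truncations `T ∩ [a, ∞)` are then glued. -/

namespace TimeScale

/-! ### Forward jump and graininess -/

section Jump

variable {T : Set ℝ} {s t : ℝ}

lemma nonempty_gt (hub : ¬ BddAbove T) (t : ℝ) : {s | s ∈ T ∧ t < s}.Nonempty := by
  obtain ⟨s, hs, h⟩ := not_bddAbove_iff.1 hub t
  exact ⟨s, hs, h⟩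

lemma bddBelow_gt (T : Set ℝ) (t : ℝ) : BddBelow {s | s ∈ T ∧ t < s} :=
  ⟨t, fun _ h => h.2.le⟩

lemma sigma_le (hs : s ∈ T) (h : t < s) : sigma T t ≤ s :=
  csInf_le (bddBelow_gt T t) ⟨hs, h⟩

lemma le_sigma (hub : ¬ BddAbove T) (t : ℝ) : t ≤ sigma T t :=
  le_csInf (nonempty_gt hub t) fun _ h => h.2.le

lemma sigma_mem (hT : IsClosed T) (hub : ¬ BddAbove T) (t : ℝ) : sigma T t ∈ T :=
  hT.closure_subset_iff.2 (fun _ h => h.1) (csInf_mem_closure (nonempty_gt hub t) (bddBelow_gt T t))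

lemma mu_nonneg (hub : ¬ BddAbove T) (t : ℝ) : 0 ≤ mu T t := sub_nonneg.2 (le_sigma hub t)

/-- Right-dense points are approximated from the right by points of the time scale. -/
lemma exists_right (hub : ¬ BddAbove T) (ht : sigma T t = t) {p : ℝ → Prop}
    (hp : ∀ᶠ s in 𝓝[T] t, p s) {b : ℝ} (hb : t < b) : ∃ s ∈ T, t < s ∧ s < b ∧ p s := by
  obtain ⟨δ, hδ, h⟩ := Metric.mem_nhdsWithin_iff.1 hp
  obtain ⟨s, hs, hsb⟩ := exists_lt_of_csInf_lt (nonempty_gt hub t)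
    (show sInf {s | s ∈ T ∧ t < s} < min b (t + δ) by
      rw [← sigma, ht]; exact lt_min hb (by linarith))
  refine ⟨s, hs.1, hs.2, hsb.trans_le (min_le_left _ _), h ⟨?_, hs.1⟩⟩
  have h1 := hsb.trans_le (min_le_right _ _)
  rw [Metric.mem_ball, Real.dist_eq, abs_of_pos (by linarith [hs.2])]
  linarith

lemma sigma_inter_Ici (a : ℝ) (h : a ≤ t) : sigma (T ∩ Set.Ici a) t = sigma T t := by
  have : {s | s ∈ T ∩ Set.Ici a ∧ t < s} = {s | s ∈ T ∧ t < s} := by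
    ext s
    simp only [Set.mem_inter_iff, Set.mem_Ici, Set.mem_ofPred_eq]
    constructor
    · tauto
    · rintro ⟨h1, h2⟩
      exact ⟨⟨h1, by linarith⟩, h2⟩
  rw [sigma, sigma, this]

lemma mu_inter_Ici (a : ℝ) (h : a ≤ t) : mu (T ∩ Set.Ici a) t = mu T t := by
  rw [mu, mu, sigma_inter_Ici a h]

lemma not_bddAbove_inter_Ici (hub : ¬ BddAbove T) (a : ℝ) : ¬ BddAbove (T ∩ Set.Ici a) := by
  rw [not_bddAbove_iff] at hub ⊢
  intro x
  obtain ⟨y, hy, h⟩ := hub (max x a)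
  exact ⟨y, ⟨hy, (le_max_right _ _).trans h.le⟩, (le_max_left _ _).trans_lt h⟩

end Jump

/-! ### Calculus of the delta derivative -/

section Deriv

variable {T : Set ℝ} {f g : ℝ → ℝ} {d e t : ℝ}

lemma hasDeltaDerivAt_iff : HasDeltaDerivAt T f d t ↔
    (fun s => f (sigma T t) - f s - d * (sigma T t - s)) =o[𝓝[T] t] fun s => sigma T t - s := by
  rw [Asymptotics.isLittleO_iff]
  rfl

lemma tendsto_sigma_sub (T : Set ℝ) (t : ℝ) :
    Tendsto (fun s => sigma T t - s) (𝓝[T] t) (𝓝 (mu T t)) :=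
  ((continuous_const.sub continuous_id).tendsto t).mono_left nhdsWithin_le_nhds

/-- The defining inequality may be tested at `s = t` itself; holding there for every `ε`, it becomes
an equality. -/
lemma HasDeltaDerivAt.apply_sigma (h : HasDeltaDerivAt T f d t) (ht : t ∈ T) :
    f (sigma T t) = f t + mu T t * d := by
  by_contra hne
  have h0 : 0 < |f (sigma T t) - f t - d * (sigma T t - t)| := by
    rw [abs_pos]
    intro h1
    exact hne (by rw [mu]; linarith)
  have hpos : 0 ≤ |sigma T t - t| := abs_nonneg _
  have h1 := (h (|f (sigma T t) - f t - d * (sigma T t - t)| / (|sigma T t - t| + 1))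
    (by positivity)).self_of_nhdsWithin ht
  rw [div_mul_eq_mul_div, le_div_iff₀ (by positivity)] at h1
  nlinarith

lemma HasDeltaDerivAt.continuousWithinAt (h : HasDeltaDerivAt T f d t) (ht : t ∈ T) :
    ContinuousWithinAt f T t := by
  have h1 : Tendsto (fun s => f (sigma T t) - f s - d * (sigma T t - s)) (𝓝[T] t) (𝓝 0) := by
    have h2 := (hasDeltaDerivAt_iff.1 h).trans_isBigO ((tendsto_sigma_sub T t).isBigO_one ℝ)
    exact (Asymptotics.isLittleO_one_iff ℝ).1 h2
  have h3 := ((tendsto_const_nhds (x := f (sigma T t))).sub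
    ((tendsto_sigma_sub T t).const_mul d)).sub h1
  have h4 : f (sigma T t) - d * mu T t - 0 = f t := by
    rw [h.apply_sigma ht]; ring
  rw [h4] at h3
  refine h3.congr fun s => ?_
  ring

lemma HasDeltaDerivAt.unique (hub : ¬ BddAbove T) (ht : t ∈ T) (h : HasDeltaDerivAt T f d t)
    (h' : HasDeltaDerivAt T f e t) : d = e := by
  rcases (le_sigma hub t).eq_or_lt with heq | hlt
  · by_contra hne
    have hpos : 0 < |d - e| := abs_pos.2 (sub_ne_zero.2 hne)
    obtain ⟨s, -, hts, -, h1, h2⟩ := exists_right hub heq.symm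
      ((h (|d - e| / 3) (by positivity)).and (h' (|d - e| / 3) (by positivity)))
      (lt_add_one t)
    rw [← heq] at h1 h2
    have h3 : (d - e) * (s - t) = (f t - f s - e * (t - s)) * (-1) + (f t - f s - d * (t - s)) := by
      ring
    have h4 : |d - e| * |s - t| ≤ |d - e| / 3 * |t - s| + |d - e| / 3 * |t - s| := by
      rw [← abs_mul, h3]
      refine (abs_add_le _ _).trans (add_le_add ?_ h1)
      rw [abs_mul]
      simpa using h2
    rw [abs_sub_comm t s] at h4
    have h5 : 0 < |s - t| := abs_pos.2 (sub_ne_zero.2 hts.ne')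
    nlinarith [mul_pos hpos h5]
  · have h1 := h.apply_sigma ht
    rw [h'.apply_sigma ht] at h1
    have h2 : mu T t ≠ 0 := (sub_pos.2 hlt).ne'
    exact (mul_left_cancel₀ h2 (by linarith)).symm

lemma HasDeltaDerivAt.const (T : Set ℝ) (c t : ℝ) : HasDeltaDerivAt T (fun _ => c) 0 t := by
  rw [hasDeltaDerivAt_iff]
  simp

lemma HasDeltaDerivAt.add (hf : HasDeltaDerivAt T f d t) (hg : HasDeltaDerivAt T g e t) :
    HasDeltaDerivAt T (fun s => f s + g s) (d + e) t := by
  rw [hasDeltaDerivAt_iff] at *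
  exact (hf.add hg).congr_left fun s => by ring

/-- Besides the two scaled errors of `f` and `g`, the remainder contains `(f s - f t) * e * (σ(t) -
s)`, which is small because `f` is continuous at `t`. -/
lemma HasDeltaDerivAt.mul (hf : HasDeltaDerivAt T f d t) (hg : HasDeltaDerivAt T g e t)
    (ht : t ∈ T) :
    HasDeltaDerivAt T (fun s => f s * g s) (d * g (sigma T t) + f t * e) t := by
  have hc : Tendsto f (𝓝[T] t) (𝓝 (f t)) := hf.continuousWithinAt ht
  rw [hasDeltaDerivAt_iff] at *
  have h1 := hf.const_mul_left (g (sigma T t))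
  have h2 := (hc.isBigO_one ℝ).mul_isLittleO hg
  have h3 : (fun s => (f s - f t) * (e * (sigma T t - s))) =o[𝓝[T] t]
      fun s => 1 * (sigma T t - s) := by
    refine Asymptotics.IsLittleO.mul_isBigO ?_ (Asymptotics.isBigO_const_mul_self _ _ _)
    rw [Asymptotics.isLittleO_one_iff]
    simpa using hc.sub_const (f t)
  simp only [one_mul] at h2 h3
  exact ((h1.add h2).add h3).congr_left fun s => by ring

lemma HasDeltaDerivAt.const_mul (c : ℝ) (hf : HasDeltaDerivAt T f d t) :
    HasDeltaDerivAt T (fun s => c * f s) (c * d) t := by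
  rw [hasDeltaDerivAt_iff] at *
  exact (hf.const_mul_left c).congr_left fun s => by ring

lemma HasDeltaDerivAt.neg (hf : HasDeltaDerivAt T f d t) :
    HasDeltaDerivAt T (fun s => -f s) (-d) t := by
  simpa using hf.const_mul (-1)

lemma HasDeltaDerivAt.sum {ι : Type*} (u : Finset ι) {F : ι → ℝ → ℝ} {D : ι → ℝ}
    (h : ∀ i ∈ u, HasDeltaDerivAt T (F i) (D i) t) :
    HasDeltaDerivAt T (fun s => ∑ i ∈ u, F i s) (∑ i ∈ u, D i) t := by
  classical
  induction u using Finset.induction_on with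
  | empty => simpa using HasDeltaDerivAt.const T 0 t
  | insert i u hi ih =>
    simp only [Finset.sum_insert hi]
    exact (h i (Finset.mem_insert_self i u)).add
      (ih fun j hj => h j (Finset.mem_insert_of_mem hj))

lemma HasDeltaDerivAt.congr (h : HasDeltaDerivAt T f d t) (hs : sigma T t ∈ T)
    (hfg : ∀ s ∈ T, g s = f s) : HasDeltaDerivAt T g d t := by
  intro ε hε
  filter_upwards [h ε hε, self_mem_nhdsWithin] with s h1 h2
  rwa [hfg s h2, hfg _ hs]

lemma HasDeltaDerivAt.inter_Ici {a : ℝ} (h : HasDeltaDerivAt T f d t) (ha : a ≤ t) :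
    HasDeltaDerivAt (T ∩ Set.Ici a) f d t := by
  intro ε hε
  rw [sigma_inter_Ici a ha]
  exact (h ε hε).filter_mono (nhdsWithin_mono _ Set.inter_subset_left)

/-- Under `ha` the truncated scale agrees with `T` near `t`; for `a = t` not least in `T`, points to
the left would be lost. -/
lemma HasDeltaDerivAt.of_inter_Ici {a : ℝ} (h : HasDeltaDerivAt (T ∩ Set.Ici a) f d t)
    (hat : a ≤ t) (ha : a < t ∨ ∀ s ∈ T, a ≤ s) : HasDeltaDerivAt T f d t := by
  intro ε hε
  have := h ε hε
  rw [sigma_inter_Ici a hat] at this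
  rcases ha with ha | ha
  · rwa [Set.inter_comm, nhdsWithin_inter_of_mem (mem_nhdsWithin_of_mem_nhds (Ici_mem_nhds ha))] at this
  · rwa [Set.inter_eq_left.2 (show T ⊆ Set.Ici a from ha)] at this

/-- A function with nonpositive delta derivative is antitone. -/
lemma antitoneOn_of_deriv_nonpos (hT : IsClosed T) (hub : ¬ BddAbove T)
    (h : ∀ t ∈ T, ∃ d ≤ 0, HasDeltaDerivAt T f d t) : AntitoneOn f T := by
  intro a ha b hb hab
  refine le_of_forall_pos_le_add fun δ hδ => ?_
  obtain ⟨ε, hε, hεδ⟩ : ∃ ε > 0, ε * (b - a) ≤ δ := by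
    refine ⟨δ / (b - a + 1), div_pos hδ (by linarith), ?_⟩
    rw [div_mul_eq_mul_div, div_le_iff₀ (by linarith)]
    nlinarith
  have hcont : ContinuousOn f T := fun t ht => by
    obtain ⟨d, -, hd⟩ := h t ht
    exact hd.continuousWithinAt ht
  suffices hmem : b ∈ {t | t ∈ T ∧ f t ≤ f a + ε * (t - a)} by
    linarith [hmem.2]
  -- Real induction: the set is closed in `[a, b]`, and from each of its points below `b` one can
  -- advance, to a nearby point if right-dense and to `σ(x) ≤ b` if right-scattered.
  refine IsClosed.mem_of_ge_of_forall_exists_gt (a := a) ?_ ⟨ha, by simp⟩ hab ?_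
  · refine IsClosed.inter ?_ isClosed_Icc
    exact hT.isClosed_le hcont (by fun_prop)
  · rintro x ⟨⟨hx, hxa⟩, hax, hxb⟩
    obtain ⟨d, hd0, hd⟩ := h x hx
    rcases (le_sigma hub x).eq_or_lt with heq | hlt
    · obtain ⟨s, hs, hxs, hsb, h1⟩ := exists_right hub heq.symm (hd ε hε) hxb
      refine ⟨s, ⟨hs, ?_⟩, hxs, hsb.le⟩
      rw [← heq, abs_of_neg (sub_neg.2 hxs)] at h1
      have := (abs_le.1 h1).1
      nlinarith
    · refine ⟨sigma T x, ⟨sigma_mem hT hub x, ?_⟩, hlt, sigma_le hb hxb⟩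
      rw [hd.apply_sigma hx]
      have := mu_nonneg hub x
      have hmu : mu T x = sigma T x - x := rfl
      nlinarith

lemma eq_of_deriv_zero (hT : IsClosed T) (hub : ¬ BddAbove T)
    (h : ∀ t ∈ T, HasDeltaDerivAt T f 0 t) {a b : ℝ} (ha : a ∈ T) (hb : b ∈ T) : f a = f b := by
  have key : ∀ a ∈ T, ∀ b ∈ T, a ≤ b → f a = f b := fun a ha b hb hab => by
    have h1 := antitoneOn_of_deriv_nonpos hT hub (fun t ht => ⟨0, le_rfl, h t ht⟩) ha hb hab
    have h2 := antitoneOn_of_deriv_nonpos hT hub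
      (fun t ht => ⟨0, le_rfl, by simpa using (h t ht).neg⟩) ha hb hab
    linarith
  rcases le_total a b with hab | hab
  · exact key a ha b hb hab
  · exact (key b hb a ha hab).symm

/-- A function with negative delta derivative takes a smaller value somewhere to the right. -/
lemma exists_lt_of_deriv_neg (hT : IsClosed T) (hub : ¬ BddAbove T) (ht : t ∈ T)
    (h : HasDeltaDerivAt T f d t) (hd : d < 0) : ∃ s ∈ T, t < s ∧ f s < f t := by
  rcases (le_sigma hub t).eq_or_lt with heq | hlt
  · obtain ⟨s, hs, hts, -, h1⟩ := exists_right hub heq.symm (h (-d / 2) (by linarith))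
      (lt_add_one t)
    refine ⟨s, hs, hts, ?_⟩
    rw [← heq, abs_of_neg (sub_neg.2 hts)] at h1
    have := (abs_le.1 h1).1
    nlinarith
  · refine ⟨sigma T t, sigma_mem hT hub t, hlt, ?_⟩
    rw [h.apply_sigma ht]
    have hmu : mu T t = sigma T t - t := rfl
    nlinarith

end Deriv

/-! ### Delta derivatives of matrix functions -/

section MatDeriv

variable {n : ℕ} {T : Set ℝ} {F G : ℝ → Matrix (Fin n) (Fin n) ℝ}
  {D E : Matrix (Fin n) (Fin n) ℝ} {t : ℝ}

lemma MatHasDeltaDerivAt.apply_sigma (h : MatHasDeltaDerivAt T F D t) (ht : t ∈ T) :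
    F (sigma T t) = F t + mu T t • D := by
  ext i j
  simpa using (h i j).apply_sigma ht

lemma MatHasDeltaDerivAt.unique (hub : ¬ BddAbove T) (ht : t ∈ T)
    (h : MatHasDeltaDerivAt T F D t) (h' : MatHasDeltaDerivAt T F E t) : D = E := by
  ext i j
  exact (h i j).unique hub ht (h' i j)

lemma MatHasDeltaDerivAt.const (T : Set ℝ) (C : Matrix (Fin n) (Fin n) ℝ) (t : ℝ) :
    MatHasDeltaDerivAt T (fun _ => C) 0 t :=
  fun i j => HasDeltaDerivAt.const T (C i j) t

lemma MatHasDeltaDerivAt.add (hF : MatHasDeltaDerivAt T F D t) (hG : MatHasDeltaDerivAt T G E t) :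
    MatHasDeltaDerivAt T (fun s => F s + G s) (D + E) t :=
  fun i j => (hF i j).add (hG i j)

lemma MatHasDeltaDerivAt.neg (hF : MatHasDeltaDerivAt T F D t) :
    MatHasDeltaDerivAt T (fun s => -F s) (-D) t :=
  fun i j => (hF i j).neg

lemma MatHasDeltaDerivAt.sub (hF : MatHasDeltaDerivAt T F D t) (hG : MatHasDeltaDerivAt T G E t) :
    MatHasDeltaDerivAt T (fun s => F s - G s) (D - E) t := by
  simpa only [sub_eq_add_neg] using hF.add hG.neg

lemma MatHasDeltaDerivAt.transpose (hF : MatHasDeltaDerivAt T F D t) :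
    MatHasDeltaDerivAt T (fun s => (F s)ᵀ) Dᵀ t :=
  fun i j => hF j i

lemma MatHasDeltaDerivAt.mul (hF : MatHasDeltaDerivAt T F D t) (hG : MatHasDeltaDerivAt T G E t)
    (ht : t ∈ T) :
    MatHasDeltaDerivAt T (fun s => F s * G s) (D * G (sigma T t) + F t * E) t := by
  intro i j
  simp only [Matrix.add_apply, Matrix.mul_apply, ← Finset.sum_add_distrib]
  exact HasDeltaDerivAt.sum _ fun k _ => (hF i k).mul (hG k j) ht

lemma MatHasDeltaDerivAt.congr (h : MatHasDeltaDerivAt T F D t) (hs : sigma T t ∈ T)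
    (hFG : ∀ s ∈ T, G s = F s) : MatHasDeltaDerivAt T G D t :=
  fun i j => (h i j).congr hs fun s hs => by rw [hFG s hs]

lemma MatHasDeltaDerivAt.inter_Ici {a : ℝ} (h : MatHasDeltaDerivAt T F D t) (ha : a ≤ t) :
    MatHasDeltaDerivAt (T ∩ Set.Ici a) F D t :=
  fun i j => (h i j).inter_Ici ha

lemma MatHasDeltaDerivAt.of_inter_Ici {a : ℝ} (h : MatHasDeltaDerivAt (T ∩ Set.Ici a) F D t)
    (hat : a ≤ t) (ha : a < t ∨ ∀ s ∈ T, a ≤ s) : MatHasDeltaDerivAt T F D t :=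
  fun i j => (h i j).of_inter_Ici hat ha

lemma eq_of_matDeriv_zero (hT : IsClosed T) (hub : ¬ BddAbove T)
    (h : ∀ t ∈ T, MatHasDeltaDerivAt T F 0 t) {a b : ℝ} (ha : a ∈ T) (hb : b ∈ T) :
    F a = F b := by
  ext i j
  exact eq_of_deriv_zero hT hub (fun t ht => h t ht i j) ha hb

/-- The derivative of the quadratic form `xᵀ F x` of a matrix function. -/
lemma MatHasDeltaDerivAt.quadForm (hF : MatHasDeltaDerivAt T F D t) (y : Fin n → ℝ) :
    HasDeltaDerivAt T (fun s => y ⬝ᵥ (F s *ᵥ y)) (y ⬝ᵥ (D *ᵥ y)) t := by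
  simp only [dotProduct, Matrix.mulVec]
  exact HasDeltaDerivAt.sum _ fun i _ => HasDeltaDerivAt.const_mul _ <|
    HasDeltaDerivAt.sum _ fun j _ => by
      simpa only [mul_comm _ (y j)] using (hF i j).const_mul (y j)

lemma MatHasDeltaDerivAt.mulVec {x : ℝ → Fin n → ℝ} {d : Fin n → ℝ}
    (hF : MatHasDeltaDerivAt T F D t) (hx : VecHasDeltaDerivAt T x d t) (ht : t ∈ T) :
    VecHasDeltaDerivAt T (fun s => F s *ᵥ x s) (D *ᵥ x (sigma T t) + F t *ᵥ d) t := by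
  intro i
  simp only [Pi.add_apply, Matrix.mulVec, dotProduct, ← Finset.sum_add_distrib]
  exact HasDeltaDerivAt.sum _ fun k _ => (hF i k).mul (hx k) ht

lemma VecHasDeltaDerivAt.apply_sigma {x : ℝ → Fin n → ℝ} {d : Fin n → ℝ}
    (hx : VecHasDeltaDerivAt T x d t) (ht : t ∈ T) : x (sigma T t) = x t + mu T t • d := by
  ext i
  simpa using (hx i).apply_sigma ht

lemma VecHasDeltaDerivAt.dotProduct {x y : ℝ → Fin n → ℝ} {d e : Fin n → ℝ}
    (hx : VecHasDeltaDerivAt T x d t) (hy : VecHasDeltaDerivAt T y e t) (ht : t ∈ T) :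
    HasDeltaDerivAt T (fun s => x s ⬝ᵥ y s) (d ⬝ᵥ y (sigma T t) + x t ⬝ᵥ e) t := by
  simp only [_root_.dotProduct, ← Finset.sum_add_distrib]
  exact HasDeltaDerivAt.sum _ fun k _ => (hx k).mul (hy k) ht

end MatDeriv

end TimeScale

namespace TimeScale

/-! ### The delta measure as an image of Lebesgue measure -/

/-- The largest point of `T` that is at most `s`. -/
noncomputable def floorPt (T : Set ℝ) (s : ℝ) : ℝ := sSup (T ∩ Set.Iic s)

section Floor

variable {T : Set ℝ} {a b s t : ℝ}

lemma bddAbove_inter_Iic (T : Set ℝ) (s : ℝ) : BddAbove (T ∩ Set.Iic s) := ⟨s, fun _ h => h.2⟩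

lemma floorPt_mem_inter (hT : IsClosed T) (ha : a ∈ T) (has : a ≤ s) :
    floorPt T s ∈ T ∩ Set.Iic s :=
  (hT.inter isClosed_Iic).csSup_mem ⟨a, ha, has⟩ (bddAbove_inter_Iic T s)

lemma floorPt_mem (hT : IsClosed T) (ha : a ∈ T) (has : a ≤ s) : floorPt T s ∈ T :=
  (floorPt_mem_inter hT ha has).1

lemma floorPt_le (hT : IsClosed T) (ha : a ∈ T) (has : a ≤ s) : floorPt T s ≤ s :=
  (floorPt_mem_inter hT ha has).2

lemma le_floorPt (ht : t ∈ T) (hts : t ≤ s) : t ≤ floorPt T s :=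
  le_csSup (bddAbove_inter_Iic T s) ⟨ht, hts⟩

lemma floorPt_of_mem (hT : IsClosed T) (ht : t ∈ T) : floorPt T t = t :=
  le_antisymm (floorPt_le hT ht le_rfl) (le_floorPt ht le_rfl)

lemma floorPt_eq (hT : IsClosed T) (ht : t ∈ T) (hts : t ≤ s) (hs : s < sigma T t) :
    floorPt T s = t := by
  refine le_antisymm (not_lt.1 fun h => ?_) (le_floorPt ht hts)
  exact (sigma_le (floorPt_mem hT ht hts) h).not_gt ((floorPt_le hT ht hts).trans_lt hs)

/-- If the floor point were right-dense, `T` would have points strictly between it and `s`,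
contradicting maximality. -/
lemma lt_sigma_floorPt (hT : IsClosed T) (hub : ¬ BddAbove T) (ha : a ∈ T) (has : a ≤ s)
    (hs : s ∉ T) : s < sigma T (floorPt T s) := by
  rcases (le_sigma hub (floorPt T s)).eq_or_lt with heq | hlt
  · have h1 := floorPt_mem_inter hT ha has
    have h2 : floorPt T s < s := h1.2.lt_of_ne fun h => hs (h ▸ h1.1)
    obtain ⟨r, hr, h3, h4, -⟩ := exists_right hub heq.symm (p := fun _ => True)
      (Eventually.of_forall fun _ => trivial) h2
    exact absurd (le_floorPt hr h4.le) (not_le.2 h3)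
  · by_contra! h
    exact absurd (le_floorPt (sigma_mem hT hub _) h) (not_le.2 hlt)

lemma monotoneOn_floorPt (ha : a ∈ T) : MonotoneOn (floorPt T) (Set.Ici a) := fun _ hx y _ hxy =>
  csSup_le_csSup (bddAbove_inter_Iic T y) ⟨a, ha, hx⟩
    (Set.inter_subset_inter_right _ (Set.Iic_subset_Iic.2 hxy))

lemma aemeasurable_floorPt (ha : a ∈ T) {u : Set ℝ} (hu : u ⊆ Set.Ici a) :
    AEMeasurable (floorPt T) (volume.restrict u) :=
  (aemeasurable_restrict_of_monotoneOn measurableSet_Ici (monotoneOn_floorPt ha)).mono_measure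
    (Measure.restrict_mono hu le_rfl)

lemma countable_rightScattered (T : Set ℝ) : {t : ℝ | t ∈ T ∧ t < sigma T t}.Countable := by
  refine Set.PairwiseDisjoint.countable_of_Ioo (y := sigma T) ?_ fun x hx => hx.2
  intro x hx y hy hxy
  rw [Function.onFun, Set.disjoint_left]
  intro z hz hz'
  rcases lt_or_gt_of_ne hxy with h | h
  · exact (sigma_le hy.1 h).not_gt (hz'.1.trans hz.2)
  · exact (sigma_le hx.1 h).not_gt (hz.1.trans hz'.2)

instance (T : Set ℝ) : Countable {t : ℝ // t ∈ T ∧ t < sigma T t} :=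
  (countable_rightScattered T).to_subtype

/-- `floorPt` fixes `T` and collapses each gap `(t, σ(t))` to its left end. A gap starting before
`b` also ends by `b`, because `b ∈ T`. -/
lemma floorPt_preimage (hT : IsClosed T) (hub : ¬ BddAbove T) (ha : a ∈ T) (hb : b ∈ T)
    (E : Set ℝ) :
    floorPt T ⁻¹' E ∩ Set.Ico a b = (E ∩ Set.Ico a b ∩ T) ∪
      ⋃ t : {t : ℝ // t ∈ T ∧ t < sigma T t},
        {x | x ∈ Set.Ioo (t : ℝ) (sigma T t) ∧ (t : ℝ) ∈ E ∩ Set.Ico a b} := by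
  ext x
  simp only [Set.mem_inter_iff, Set.mem_preimage, Set.mem_union, Set.mem_iUnion,
    Set.mem_ofPred_eq]
  constructor
  · rintro ⟨hx, hax, hxb⟩
    by_cases hxT : x ∈ T
    · left
      rw [floorPt_of_mem hT hxT] at hx
      exact ⟨⟨hx, hax, hxb⟩, hxT⟩
    · right
      have h1 := floorPt_mem_inter hT ha hax
      have h2 : floorPt T x < x := h1.2.lt_of_ne fun h => hxT (h ▸ h1.1)
      have h3 := lt_sigma_floorPt hT hub ha hax hxT
      exact ⟨⟨floorPt T x, h1.1, h2.trans h3⟩, ⟨h2, h3⟩, hx, le_floorPt ha hax, h2.trans hxb⟩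
  · rintro (⟨⟨hx, hax, hxb⟩, hxT⟩ | ⟨⟨t, htT, hts⟩, ⟨h1, h2⟩, h3, h4, h5⟩)
    · rw [floorPt_of_mem hT hxT]
      exact ⟨hx, hax, hxb⟩
    · dsimp only at h1 h2 h3 h4 h5
      rw [floorPt_eq hT htT h1.le h2]
      exact ⟨h3, h4.trans h1.le, h2.trans_le (sigma_le hb h5)⟩

/-- Each collapsed gap has length `μ(t)`, exactly the mass of the atom at `t`; the gaps are
countably many and disjoint. -/
lemma deltaMeasure_restrict (hT : IsClosed T) (hub : ¬ BddAbove T) (ha : a ∈ T) (hb : b ∈ T) :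
    (deltaMeasure T).restrict (Set.Ico a b) =
      (volume.restrict (Set.Ico a b)).map (floorPt T) := by
  have hmeas : AEMeasurable (floorPt T) (volume.restrict (Set.Ico a b)) :=
    aemeasurable_floorPt ha Set.Ico_subset_Ici_self
  ext E hE
  have hEI : MeasurableSet (E ∩ Set.Ico a b) := hE.inter measurableSet_Ico
  rw [Measure.map_apply_of_aemeasurable hmeas hE, Measure.restrict_apply hE,
    Measure.restrict_apply' measurableSet_Ico, floorPt_preimage hT hub ha hb, deltaMeasure,
    Measure.add_apply, Measure.restrict_apply hEI, Measure.sum_apply _ hEI]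
  have hmeasU : ∀ t : {t : ℝ // t ∈ T ∧ t < sigma T t}, MeasurableSet
      {x | x ∈ Set.Ioo (t : ℝ) (sigma T t) ∧ (t : ℝ) ∈ E ∩ Set.Ico a b} := fun t =>
    measurableSet_Ioo.inter (MeasurableSet.const _)
  rw [measure_union _ (MeasurableSet.iUnion hmeasU), measure_iUnion _ hmeasU]
  · congr 1
    refine tsum_congr fun t => ?_
    by_cases h : (t : ℝ) ∈ E ∩ Set.Ico a b
    · simp only [h, and_true, Set.ofPred_mem_eq, Real.volume_Ioo]
      simp [Measure.dirac_apply' _ hEI, h, mu]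
    · simp only [h, and_false, Set.ofPred_false, measure_empty]
      simp [Measure.dirac_apply' _ hEI, h]
  · intro s t hst
    rw [Function.onFun, Set.disjoint_left]
    rintro x ⟨hx, -⟩ ⟨hx', -⟩
    refine hst (Subtype.ext ?_)
    rw [← floorPt_eq hT s.2.1 hx.1.le hx.2, floorPt_eq hT t.2.1 hx'.1.le hx'.2]
  · rw [Set.disjoint_left]
    rintro x ⟨-, hx⟩ hx'
    obtain ⟨t, ht, -⟩ := Set.mem_iUnion.1 hx'
    exact (sigma_le hx ht.1).not_gt ht.2

end Floor

/-! ### Functions that are continuous at right-dense points and locally bounded -/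

/-- Functions that are continuous at right-dense points and locally bounded. -/
structure WeaklyRd (T : Set ℝ) (f : ℝ → ℝ) : Prop where
  continuous : ∀ t ∈ T, sigma T t = t → ContinuousWithinAt f T t
  bounded : ∀ t ∈ T, ∃ C, ∀ᶠ s in 𝓝[T] t, |f s| ≤ C

section WeaklyRd

variable {T : Set ℝ} {f g : ℝ → ℝ} {a b c t : ℝ}

/-- Near a right-scattered point there is nothing of `T` to the right. -/
lemma nhdsWithin_le_of_rightScattered (h : t < sigma T t) :
    𝓝[T] t ≤ 𝓝[T ∩ Set.Iio t] t ⊔ pure t := by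
  intro u hu
  obtain ⟨hu1, hu2⟩ := mem_sup.1 hu
  have h1 := mem_nhdsWithin_iff_eventually.1 hu1
  have h2 : t ∈ u := hu2
  refine mem_nhdsWithin_iff_eventually.2 ?_
  filter_upwards [h1, Iio_mem_nhds h] with s hs hsσ hsT
  rcases lt_trichotomy s t with hst | rfl | hst
  · exact hs ⟨hsT, hst⟩
  · exact h2
  · exact absurd (sigma_le hsT hst) (not_le.2 hsσ)

lemma Tendsto.eventually_abs_le {l : Filter ℝ} {y : ℝ} (h : Tendsto f l (𝓝 y)) :
    ∀ᶠ s in l, |f s| ≤ |y| + 1 :=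
  (h.abs.eventually_lt_const (lt_add_one _)).mono fun _ h => h.le

/-- Local boundedness suffices for integration and, unlike left limits, needs no tracking of
one-sided values through sums and products. At a right-scattered point the bound must also cover the
value at the point. -/
lemma RdContinuous.weaklyRd (hub : ¬ BddAbove T) (h : RdContinuous T f) : WeaklyRd T f := by
  refine ⟨h.1, fun t ht => ?_⟩
  rcases (le_sigma hub t).eq_or_lt with heq | hlt
  · exact ⟨_, Tendsto.eventually_abs_le (h.1 t ht heq.symm)⟩
  · obtain ⟨l, hl⟩ := h.2 t ht
    refine ⟨max (|l| + 1) |f t|, Filter.Eventually.filter_mono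
      (nhdsWithin_le_of_rightScattered hlt) (eventually_sup.2 ⟨?_, ?_⟩)⟩
    · exact (Tendsto.eventually_abs_le hl).mono fun s hs => hs.trans (le_max_left _ _)
    · exact eventually_pure.2 (le_max_right _ _)

lemma ContinuousOn.weaklyRd (h : ContinuousOn f T) : WeaklyRd T f :=
  ⟨fun t ht _ => h t ht, fun t ht => ⟨_, Tendsto.eventually_abs_le (h t ht)⟩⟩

lemma WeaklyRd.const (T : Set ℝ) (c : ℝ) : WeaklyRd T fun _ => c :=
  ContinuousOn.weaklyRd continuousOn_const

lemma WeaklyRd.add (hf : WeaklyRd T f) (hg : WeaklyRd T g) : WeaklyRd T fun s => f s + g s := by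
  refine ⟨fun t ht h => (hf.continuous t ht h).add (hg.continuous t ht h), fun t ht => ?_⟩
  obtain ⟨C, hC⟩ := hf.bounded t ht
  obtain ⟨D, hD⟩ := hg.bounded t ht
  refine ⟨C + D, ?_⟩
  filter_upwards [hC, hD] with s h1 h2
  exact (abs_add_le _ _).trans (add_le_add h1 h2)

lemma WeaklyRd.mul (hf : WeaklyRd T f) (hg : WeaklyRd T g) : WeaklyRd T fun s => f s * g s := by
  refine ⟨fun t ht h => (hf.continuous t ht h).mul (hg.continuous t ht h), fun t ht => ?_⟩
  obtain ⟨C, hC⟩ := hf.bounded t ht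
  obtain ⟨D, hD⟩ := hg.bounded t ht
  refine ⟨C * D, ?_⟩
  filter_upwards [hC, hD] with s h1 h2
  rw [abs_mul]
  exact mul_le_mul h1 h2 (abs_nonneg _) ((abs_nonneg _).trans h1)

lemma WeaklyRd.sum {ι : Type*} (u : Finset ι) {F : ι → ℝ → ℝ} (h : ∀ i ∈ u, WeaklyRd T (F i)) :
    WeaklyRd T fun s => ∑ i ∈ u, F i s := by
  classical
  induction u using Finset.induction_on with
  | empty => simpa using WeaklyRd.const T 0
  | insert i u hi ih =>
    simp only [Finset.sum_insert hi]
    exact (h i (Finset.mem_insert_self i u)).add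
      (ih fun j hj => h j (Finset.mem_insert_of_mem hj))

lemma WeaklyRd.bounded_Icc (hT : IsClosed T) (hf : WeaklyRd T f) (a b : ℝ) :
    ∃ C, ∀ s ∈ T ∩ Set.Icc a b, |f s| ≤ C := by
  have hK : IsCompact (T ∩ Set.Icc a b) := isCompact_Icc.inter_left hT
  refine hK.induction_on (p := fun u => ∃ C, ∀ s ∈ u, |f s| ≤ C) ⟨0, by simp⟩ ?_ ?_ ?_
  · rintro u v huv ⟨C, hC⟩
    exact ⟨C, fun s hs => hC s (huv hs)⟩
  · rintro u v ⟨C, hC⟩ ⟨D, hD⟩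
    refine ⟨max C D, ?_⟩
    rintro s (hs | hs)
    · exact (hC s hs).trans (le_max_left _ _)
    · exact (hD s hs).trans (le_max_right _ _)
  · intro t ht
    obtain ⟨C, hC⟩ := hf.bounded t ht.1
    exact ⟨_, nhdsWithin_mono _ Set.inter_subset_left hC, C, fun s hs => hs⟩

/-- Off the countable set of right-scattered points, `f` is continuous on `T`. -/
lemma WeaklyRd.measurable_indicator (hT : IsClosed T) (hub : ¬ BddAbove T) (hf : WeaklyRd T f) :
    Measurable (T.indicator f) := by
  classical
  set S := {t : ℝ | t ∈ T ∧ t < sigma T t}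
  have hSc : S.Countable := countable_rightScattered T
  have hd : ContinuousOn f (T \ S) := fun t ht => by
    refine (hf.continuous t ht.1 ?_).mono Set.sdiff_subset
    exact le_antisymm (not_lt.1 fun h => ht.2 ⟨ht.1, h⟩) (le_sigma hub t)
  have h1 : Measurable ((T \ S).indicator f) := by
    rw [← Set.piecewise_eq_indicator]
    exact hd.measurable_piecewise continuousOn_const (hT.measurableSet.diff hSc.measurableSet)
  refine h1.measurable_of_countable_ne (hSc.mono fun s hs => ?_)
  by_contra h
  by_cases h' : s ∈ T <;> simp [h, h'] at hs

lemma WeaklyRd.aestronglyMeasurable_comp (hT : IsClosed T) (hub : ¬ BddAbove T)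
    (hf : WeaklyRd T f) (ha : a ∈ T) {u : Set ℝ} (hm : MeasurableSet u) (hu : u ⊆ Set.Ici a) :
    AEStronglyMeasurable (fun s => f (floorPt T s)) (volume.restrict u) := by
  have h := ((hf.measurable_indicator hT hub).comp_aemeasurable
    (aemeasurable_floorPt ha hu)).aestronglyMeasurable
  refine h.congr ?_
  filter_upwards [ae_restrict_mem hm] with s hs
  simp [floorPt_mem hT ha (hu hs)]

lemma WeaklyRd.intervalIntegrable (hT : IsClosed T) (hub : ¬ BddAbove T) (hf : WeaklyRd T f)
    (ha : a ∈ T) (hb : a ≤ b) (hc : a ≤ c) :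
    IntervalIntegrable (fun s => f (floorPt T s)) volume b c := by
  have hsub : Set.uIoc b c ⊆ Set.Ici a := fun s hs => (le_min hb hc).trans hs.1.le
  obtain ⟨C, hC⟩ := hf.bounded_Icc hT a (max b c)
  rw [intervalIntegrable_iff]
  refine IntegrableOn.of_bound (by simp)
    (hf.aestronglyMeasurable_comp hT hub ha measurableSet_uIoc hsub) C ?_
  filter_upwards [ae_restrict_mem measurableSet_uIoc] with s hs
  have h := hsub hs
  exact hC _ ⟨floorPt_mem hT ha h, le_floorPt ha h, (floorPt_le hT ha h).trans hs.2⟩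

lemma setIntegral_deltaMeasure (hT : IsClosed T) (hub : ¬ BddAbove T) (hf : WeaklyRd T f)
    (ha : a ∈ T) (hb : b ∈ T) :
    ∫ s in Set.Ico a b, f s ∂(deltaMeasure T) = ∫ s in Set.Ico a b, f (floorPt T s) := by
  have hmeas : AEMeasurable (floorPt T) (volume.restrict (Set.Ico a b)) :=
    aemeasurable_floorPt ha Set.Ico_subset_Ici_self
  rw [deltaMeasure_restrict hT hub ha hb, integral_map hmeas]
  refine ((hf.measurable_indicator hT hub).aestronglyMeasurable).congr ?_
  have : ∀ᵐ s ∂(volume.restrict (Set.Ico a b)).map (floorPt T), s ∈ T := by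
    refine (ae_map_iff hmeas hT.measurableSet).2 ?_
    filter_upwards [ae_restrict_mem measurableSet_Ico] with s hs
    exact floorPt_mem hT ha hs.1
  filter_upwards [this] with s hs
  simp [hs]

/-- The delta integral as an interval integral. -/
lemma deltaIntegral_eq (hT : IsClosed T) (hub : ¬ BddAbove T) (hf : WeaklyRd T f)
    (ha : a ∈ T) (hb : b ∈ T) :
    deltaIntegral T f a b = ∫ s in a..b, f (floorPt T s) := by
  rw [deltaIntegral, setIntegral_deltaMeasure hT hub hf ha hb,
    setIntegral_deltaMeasure hT hub hf hb ha, intervalIntegral, integral_Ico_eq_integral_Ioc,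
    integral_Ico_eq_integral_Ioc]

/-- The fundamental theorem of calculus for the delta integral. -/
lemma WeaklyRd.hasDeltaDerivAt_integral (hT : IsClosed T) (hub : ¬ BddAbove T)
    (hf : WeaklyRd T f) (ha : a ∈ T) (ht : t ∈ T) :
    HasDeltaDerivAt T (fun b => deltaIntegral T f a b) (f t) t := by
  have hσ := sigma_mem hT hub t
  have hint : ∀ {r s : ℝ}, r ∈ T → s ∈ T →
      IntervalIntegrable (fun s => f (floorPt T s)) volume r s := fun {r s} hr hs => by
    rcases le_total r s with h | h
    · exact hf.intervalIntegrable hT hub hr le_rfl h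
    · exact hf.intervalIntegrable hT hub hs h le_rfl
  have key : ∀ s ∈ T, deltaIntegral T f a (sigma T t) - deltaIntegral T f a s
      - f t * (sigma T t - s) = ∫ u in s..sigma T t, (f (floorPt T u) - f t) := fun s hs => by
    rw [deltaIntegral_eq hT hub hf ha hσ, deltaIntegral_eq hT hub hf ha hs,
      intervalIntegral.integral_sub (hint hs hσ) intervalIntegrable_const,
      intervalIntegral.integral_const, intervalIntegral.integral_interval_sub_left
        (hint ha hσ) (hint ha hs)]
    simp [mul_comm]
  intro ε hε
  rcases (le_sigma hub t).eq_or_lt with heq | hlt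
  -- Right-dense case: for `u` between `s` and `t` the floor of `u` stays between them, within the
  -- range where `f` is `ε`-close to `f t`.
  · have h1 := Metric.continuousWithinAt_iff.1 (hf.continuous t ht heq.symm) ε hε
    obtain ⟨δ, hδ, h1⟩ := h1
    filter_upwards [self_mem_nhdsWithin, mem_nhdsWithin_of_mem_nhds (Metric.ball_mem_nhds t hδ)]
      with s hs hsδ
    rw [key s hs, ← heq, ← Real.norm_eq_abs]
    refine intervalIntegral.norm_integral_le_of_norm_le_const fun u hu => ?_
    have hmin : min s t ∈ T := by rcases min_choice s t with h | h <;> rw [h] <;> assumption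
    have hu1 : min s t ≤ u := hu.1.le
    have hu2 : u ≤ max s t := hu.2
    have h2 := floorPt_mem hT hmin hu1
    have h3 := le_floorPt hmin hu1
    have h4 := (floorPt_le hT hmin hu1).trans hu2
    refine (h1 h2 ?_).le
    rw [Metric.mem_ball, Real.dist_eq, abs_lt] at hsδ
    rw [Real.dist_eq, abs_lt]
    constructor
    · rcases min_choice s t with h | h <;> rw [h] at h3 <;> linarith
    · rcases max_choice s t with h | h <;> rw [h] at h4 <;> linarith
  -- Right-scattered case: the integrand vanishes on the gap `[t, σ(t))`, leaving at most `2C(t -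
  -- s)` from the left. The choice of `δ` makes this at most `ε(σ(t) - t)`; the `+ 1` keeps the
  -- denominator positive.
  · obtain ⟨C, hC⟩ := hf.bounded_Icc hT (t - 1) t
    have hC0 : 0 ≤ C := (abs_nonneg _).trans (hC t ⟨ht, by simp⟩)
    have hmu : 0 < sigma T t - t := sub_pos.2 hlt
    have hδ : 0 < min 1 (ε * (sigma T t - t) / (2 * C + 1)) := by positivity
    filter_upwards [self_mem_nhdsWithin, mem_nhdsWithin_of_mem_nhds (Iio_mem_nhds hlt),
      mem_nhdsWithin_of_mem_nhds (Ioi_mem_nhds (sub_lt_self t hδ))] with s hs hsσ hsδ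
    have hst : s ≤ t := not_lt.1 fun h => (sigma_le hs h).not_gt hsσ
    have hsδ1 : t - s < 1 := by
      have := min_le_left 1 (ε * (sigma T t - t) / (2 * C + 1))
      have h5 : t - min 1 (ε * (sigma T t - t) / (2 * C + 1)) < s := hsδ
      linarith
    have hsδ2 : (t - s) * (2 * C + 1) ≤ ε * (sigma T t - t) := by
      rw [← le_div_iff₀ (by linarith)]
      have := min_le_right 1 (ε * (sigma T t - t) / (2 * C + 1))
      have h5 : t - min 1 (ε * (sigma T t - t) / (2 * C + 1)) < s := hsδ
      linarith
    have hz : ∫ u in t..sigma T t, (f (floorPt T u) - f t) = 0 := by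
      rw [intervalIntegral.integral_of_le hlt.le, ← integral_Ico_eq_integral_Ioc]
      refine setIntegral_eq_zero_of_forall_eq_zero fun u hu => ?_
      rw [floorPt_eq hT ht hu.1 hu.2, sub_self]
    rw [key s hs, ← intervalIntegral.integral_add_adjacent_intervals
      ((hint hs ht).sub intervalIntegrable_const) ((hint ht hσ).sub intervalIntegrable_const), hz,
      add_zero, ← Real.norm_eq_abs]
    have hb : ∀ u ∈ Set.uIoc s t, ‖f (floorPt T u) - f t‖ ≤ 2 * C := fun u hu => by
      rw [Set.uIoc_of_le hst] at hu
      have h1 := floorPt_mem hT hs hu.1.le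
      have h2 := le_floorPt hs hu.1.le
      have h3 := floorPt_le hT hs hu.1.le
      have h4 := hC _ ⟨h1, by linarith, h3.trans hu.2⟩
      have h5 := hC t ⟨ht, by simp⟩
      refine (norm_sub_le _ _).trans ?_
      rw [Real.norm_eq_abs, Real.norm_eq_abs]
      linarith
    refine (intervalIntegral.norm_integral_le_of_norm_le_const hb).trans ?_
    rw [abs_of_nonneg (sub_nonneg.2 hst), abs_of_pos (by linarith)]
    nlinarith

lemma deltaIntegral_self (T : Set ℝ) (f : ℝ → ℝ) (a : ℝ) : deltaIntegral T f a a = 0 := by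
  simp [deltaIntegral]

end WeaklyRd

end TimeScale

namespace TimeScale

/-! ### The Picard series on a time scale with least element -/

section Picard

variable {n : ℕ} {T : Set ℝ} {a : ℝ} {A : ℝ → Matrix (Fin n) (Fin n) ℝ}

/-- The terms of the Picard series of `X^Δ = A X`, `X(a) = 1`. -/
noncomputable def picardTerm (T : Set ℝ) (A : ℝ → Matrix (Fin n) (Fin n) ℝ) (a : ℝ) :
    ℕ → ℝ → Matrix (Fin n) (Fin n) ℝ
  | 0 => fun _ => 1
  | k + 1 => fun t => matDeltaIntegral T (fun s => A s * picardTerm T A a k s) a t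

lemma picardTerm_zero (t : ℝ) : picardTerm T A a 0 t = 1 := rfl

lemma picardTerm_succ_apply (k : ℕ) (t : ℝ) (i j : Fin n) : picardTerm T A a (k + 1) t i j =
    deltaIntegral T (fun s => (A s * picardTerm T A a k s) i j) a t := rfl

lemma weaklyRd_mul_apply {F G : ℝ → Matrix (Fin n) (Fin n) ℝ}
    (hF : ∀ i j, WeaklyRd T fun s => F s i j) (hG : ∀ i j, WeaklyRd T fun s => G s i j)
    (i j : Fin n) : WeaklyRd T fun s => (F s * G s) i j := by
  simp only [Matrix.mul_apply]
  exact WeaklyRd.sum _ fun l _ => (hF i l).mul (hG l j)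

/-- The fundamental theorem of calculus for matrix functions. -/
lemma matHasDeltaDerivAt_integral (hT : IsClosed T) (hub : ¬ BddAbove T)
    {F : ℝ → Matrix (Fin n) (Fin n) ℝ} (hF : ∀ i j, WeaklyRd T fun s => F s i j) (ha : a ∈ T)
    {t : ℝ} (ht : t ∈ T) : MatHasDeltaDerivAt T (fun b => matDeltaIntegral T F a b) (F t) t :=
  fun i j => (hF i j).hasDeltaDerivAt_integral hT hub ha ht

lemma matDeltaIntegral_self (T : Set ℝ) (F : ℝ → Matrix (Fin n) (Fin n) ℝ) (a : ℝ) :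
    matDeltaIntegral T F a a = 0 := by
  ext i j
  simp [matDeltaIntegral, deltaIntegral_self]

lemma continuousOn_picardTerm (hT : IsClosed T) (hub : ¬ BddAbove T) (ha : a ∈ T)
    (hA : ∀ i j, WeaklyRd T fun s => A s i j) (k : ℕ) (i j : Fin n) :
    ContinuousOn (fun t => picardTerm T A a k t i j) T := by
  induction k generalizing i j with
  | zero => exact continuousOn_const
  | succ k ih =>
    intro t ht
    exact HasDeltaDerivAt.continuousWithinAt (matHasDeltaDerivAt_integral hT hub
      (weaklyRd_mul_apply hA fun i j => ContinuousOn.weaklyRd (ih i j)) ha ht i j) ht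

lemma weaklyRd_mul_picardTerm (hT : IsClosed T) (hub : ¬ BddAbove T) (ha : a ∈ T)
    (hA : ∀ i j, WeaklyRd T fun s => A s i j) (k : ℕ) (i j : Fin n) :
    WeaklyRd T fun s => (A s * picardTerm T A a k s) i j :=
  weaklyRd_mul_apply hA
    (fun i j => ContinuousOn.weaklyRd (continuousOn_picardTerm hT hub ha hA k i j)) i j

lemma abs_mul_apply_le {P Q : Matrix (Fin n) (Fin n) ℝ} {C c : ℝ} (hP : ∀ i j, |P i j| ≤ C)
    (hQ : ∀ i j, |Q i j| ≤ c) (i j : Fin n) : |(P * Q) i j| ≤ n * C * c := by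
  rw [Matrix.mul_apply]
  refine (Finset.abs_sum_le_sum_abs _ _).trans ?_
  refine (Finset.sum_le_sum (g := fun _ => C * c) fun l _ => ?_).trans (by simp [mul_assoc])
  rw [abs_mul]
  exact mul_le_mul (hP i l) (hQ l j) (abs_nonneg _) ((abs_nonneg _).trans (hP i l))

/-- The classical factorial estimate survives because `floorPt T s ≤ s`: evaluating the inductive
bound at the floor can only decrease it. -/
lemma abs_picardTerm_le (hT : IsClosed T) (hub : ¬ BddAbove T) (ha : a ∈ T)
    (hA : ∀ i j, WeaklyRd T fun s => A s i j) {b C : ℝ} (hC0 : 0 ≤ C)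
    (hC : ∀ s ∈ T ∩ Set.Icc a b, ∀ i j, |A s i j| ≤ C) (k : ℕ) :
    ∀ t ∈ T ∩ Set.Icc a b, ∀ i j,
      |picardTerm T A a k t i j| ≤ (n * C) ^ k * (t - a) ^ k / k.factorial := by
  induction k with
  | zero =>
    intro t _ i j
    by_cases h : i = j <;> simp [picardTerm, Matrix.one_apply, h]
  | succ k ih =>
    rintro t ⟨ht, hat, htb⟩ i j
    rw [picardTerm_succ_apply, deltaIntegral_eq hT hub (weaklyRd_mul_picardTerm hT hub ha hA k i j) ha ht,
      ← Real.norm_eq_abs]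
    have hint : ∫ s in a..t, (n * C) * ((n * C) ^ k * (s - a) ^ k / k.factorial) =
        (n * C) ^ (k + 1) * (t - a) ^ (k + 1) / (k + 1).factorial := by
      have h1 : ∀ s : ℝ, (n * C) * ((n * C) ^ k * (s - a) ^ k / k.factorial) =
          ((n * C) ^ (k + 1) / k.factorial) * (s - a) ^ k := fun s => by ring
      simp_rw [h1]
      rw [intervalIntegral.integral_const_mul,
        intervalIntegral.integral_comp_sub_right (fun s => s ^ k), integral_pow, sub_self,
        Nat.factorial_succ]
      push_cast
      field_simp
      simp
    rw [← hint]
    refine intervalIntegral.norm_integral_le_of_norm_le hat ?_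
      (Continuous.intervalIntegrable (by fun_prop) _ _)
    refine Eventually.of_forall fun s hs => ?_
    have h1 := floorPt_mem hT ha hs.1.le
    have h2 := le_floorPt ha hs.1.le
    have h3 := floorPt_le hT ha hs.1.le
    have hmem : floorPt T s ∈ T ∩ Set.Icc a b := ⟨h1, h2, h3.trans (hs.2.trans htb)⟩
    refine abs_mul_apply_le (c := (n * C) ^ k * (s - a) ^ k / k.factorial) (hC _ hmem)
      (fun l j => (ih _ hmem l j).trans ?_) i j
    have h4 : 0 ≤ floorPt T s - a := sub_nonneg.2 h2
    gcongr

/-- The sum of the Picard series. -/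
noncomputable def picardSum (T : Set ℝ) (A : ℝ → Matrix (Fin n) (Fin n) ℝ) (a t : ℝ) :
    Matrix (Fin n) (Fin n) ℝ :=
  Matrix.of fun i j => ∑' k, picardTerm T A a k t i j

lemma exists_picardBound (hT : IsClosed T) (hub : ¬ BddAbove T) (ha : a ∈ T)
    (hA : ∀ i j, WeaklyRd T fun s => A s i j) (b : ℝ) :
    ∃ C, 0 ≤ C ∧ (∀ s ∈ T ∩ Set.Icc a b, ∀ i j, |A s i j| ≤ C) ∧ ∃ u : ℕ → ℝ, Summable u ∧
      ∀ k, ∀ t ∈ T ∩ Set.Icc a b, ∀ i j, |picardTerm T A a k t i j| ≤ u k := by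
  choose c hc using fun i j => (hA i j).bounded_Icc hT a b
  have hC : ∀ s ∈ T ∩ Set.Icc a b, ∀ i j, |A s i j| ≤ ∑ i, ∑ j, |c i j| := fun s hs i j =>
    ((hc i j s hs).trans (le_abs_self _)).trans <|
      (Finset.single_le_sum (f := fun j => |c i j|) (fun _ _ => abs_nonneg _)
        (Finset.mem_univ j)).trans <|
      Finset.single_le_sum (f := fun i => ∑ j, |c i j|)
        (fun _ _ => Finset.sum_nonneg fun _ _ => abs_nonneg _) (Finset.mem_univ i)
  have hC0 : 0 ≤ ∑ i, ∑ j, |c i j| :=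
    Finset.sum_nonneg fun _ _ => Finset.sum_nonneg fun _ _ => abs_nonneg _
  refine ⟨_, hC0, hC, fun k => (n * ∑ i, ∑ j, |c i j|) ^ k * (b - a) ^ k / k.factorial,
    ?_, fun k t ht i j => (abs_picardTerm_le hT hub ha hA hC0 hC k t ht i j).trans ?_⟩
  · simp_rw [← mul_pow]
    exact Real.summable_pow_div_factorial _
  · have h1 : 0 ≤ t - a := sub_nonneg.2 ht.2.1
    have h2 := ht.2.2
    beta_reduce
    gcongr

lemma continuousOn_picardSum (hT : IsClosed T) (hub : ¬ BddAbove T) (ha : a ∈ T)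
    (hmin : ∀ s ∈ T, a ≤ s) (hA : ∀ i j, WeaklyRd T fun s => A s i j) (i j : Fin n) :
    ContinuousOn (fun t => picardSum T A a t i j) T := by
  intro t ht
  obtain ⟨C, -, -, u, hu, hb⟩ := exists_picardBound hT hub ha hA (t + 1)
  have h : ContinuousOn (fun t => picardSum T A a t i j) (T ∩ Set.Icc a (t + 1)) :=
    continuousOn_tsum (fun k => (continuousOn_picardTerm hT hub ha hA k i j).mono
      Set.inter_subset_left) hu fun k s hs => hb k s hs i j
  refine (h t ⟨ht, hmin t ht, by linarith⟩).mono_of_mem_nhdsWithin ?_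
  filter_upwards [self_mem_nhdsWithin, mem_nhdsWithin_of_mem_nhds (Iic_mem_nhds (lt_add_one t))]
    with s h1 h2
  exact ⟨h1, hmin s h1, h2⟩

/-- The factorial majorant lets dominated convergence exchange sum and integral; the series shifted
by one term is then the integral. -/
lemma picardSum_eq (hT : IsClosed T) (hub : ¬ BddAbove T) (ha : a ∈ T)
    (hmin : ∀ s ∈ T, a ≤ s) (hA : ∀ i j, WeaklyRd T fun s => A s i j) {t : ℝ} (ht : t ∈ T) :
    picardSum T A a t = 1 + matDeltaIntegral T (fun s => A s * picardSum T A a s) a t := by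
  obtain ⟨C, hC0, hC, u, hu, hb⟩ := exists_picardBound hT hub ha hA t
  have hat := hmin t ht
  have hsum : ∀ s ∈ T ∩ Set.Icc a t, ∀ i j,
      HasSum (fun k => picardTerm T A a k s i j) (picardSum T A a s i j) := fun s hs i j =>
    (Summable.of_norm_bounded hu fun k => hb k s hs i j).hasSum
  have hW : ∀ i j, WeaklyRd T fun s => (A s * picardSum T A a s) i j :=
    weaklyRd_mul_apply hA fun i j =>
      ContinuousOn.weaklyRd (continuousOn_picardSum hT hub ha hmin hA i j)
  have hmem : ∀ s ∈ Set.uIoc a t, floorPt T s ∈ T ∩ Set.Icc a t := fun s hs => by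
    rw [Set.uIoc_of_le hat] at hs
    exact ⟨floorPt_mem hT ha hs.1.le, le_floorPt ha hs.1.le,
      (floorPt_le hT ha hs.1.le).trans hs.2⟩
  ext i j
  have hI : HasSum (fun k => picardTerm T A a (k + 1) t i j)
      (deltaIntegral T (fun s => (A s * picardSum T A a s) i j) a t) := by
    rw [deltaIntegral_eq hT hub (hW i j) ha ht]
    have : ∀ k, picardTerm T A a (k + 1) t i j =
        ∫ s in a..t, (A (floorPt T s) * picardTerm T A a k (floorPt T s)) i j := fun k => by
      rw [picardTerm_succ_apply]
      exact deltaIntegral_eq hT hub (weaklyRd_mul_picardTerm hT hub ha hA k i j) ha ht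
    simp_rw [this]
    refine intervalIntegral.hasSum_integral_of_dominated_convergence
      (fun k _ => n * C * u k) (fun k => ?_) (fun k => ?_) ?_ ?_ ?_
    · refine (weaklyRd_mul_picardTerm hT hub ha hA k i j).aestronglyMeasurable_comp hT hub ha
        measurableSet_uIoc fun s hs => ?_
      rw [Set.uIoc_of_le hat] at hs
      exact hs.1.le
    · exact Eventually.of_forall fun s hs =>
        abs_mul_apply_le (hC _ (hmem s hs)) (hb k _ (hmem s hs)) i j
    · exact Eventually.of_forall fun s _ => hu.mul_left _
    · exact intervalIntegrable_const
    · refine Eventually.of_forall fun s hs => ?_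
      simp only [Matrix.mul_apply]
      exact hasSum_sum fun l _ => (hsum _ (hmem s hs) l j).mul_left _
  have h0 := (hsum t ⟨ht, hat, le_rfl⟩ i j).unique (hI.zero_add (f := fun k =>
    picardTerm T A a k t i j))
  rw [h0, picardTerm_zero]
  rfl

/-- Existence of the solution of `X^Δ = A X`, `X(a) = 1` on a time scale with least
element `a`. -/
lemma exists_solution_of_least (hT : IsClosed T) (hub : ¬ BddAbove T) (ha : a ∈ T)
    (hmin : ∀ s ∈ T, a ≤ s) (hA : ∀ i j, WeaklyRd T fun s => A s i j) :
    ∃ X, SolvesMatrixIVP T A a X := by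
  refine ⟨picardSum T A a, ?_, fun t ht => ?_⟩
  · rw [picardSum_eq hT hub ha hmin hA ha, matDeltaIntegral_self, add_zero]
  · have hW : ∀ i j, WeaklyRd T fun s => (A s * picardSum T A a s) i j :=
      weaklyRd_mul_apply hA fun i j =>
        ContinuousOn.weaklyRd (continuousOn_picardSum hT hub ha hmin hA i j)
    have h := (MatHasDeltaDerivAt.const T 1 t).add (matHasDeltaDerivAt_integral hT hub hW ha ht)
    rw [zero_add] at h
    exact h.congr (sigma_mem hT hub t) fun s hs => picardSum_eq hT hub ha hmin hA hs

end Picard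

/-! ### Fundamental matrices -/

section Fundamental

variable {n : ℕ} {T : Set ℝ} {a t t₀ : ℝ} {A X Z : ℝ → Matrix (Fin n) (Fin n) ℝ}

/-- Although `μ` may be discontinuous at `t`, for `s < t` one has `σ(s) ≤ t`, so `0 ≤ μ(s) ≤ t - s`.
-/
lemma tendsto_mu_left (hub : ¬ BddAbove T) (ht : t ∈ T) :
    Tendsto (mu T) (𝓝[T ∩ Set.Iio t] t) (𝓝 0) := by
  have h : Tendsto (fun s => t - s) (𝓝[T ∩ Set.Iio t] t) (𝓝 0) := by
    simpa using ((continuous_const.sub continuous_id).tendsto t (f := fun s : ℝ => t - s)).mono_left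
      nhdsWithin_le_nhds
  refine tendsto_of_tendsto_of_tendsto_of_le_of_le' tendsto_const_nhds h
    (Eventually.of_forall fun s => mu_nonneg hub s) ?_
  filter_upwards [self_mem_nhdsWithin] with s hs
  exact sub_le_sub_right (sigma_le ht hs.2) s

lemma tendsto_mu_rightDense (hub : ¬ BddAbove T) (ht : t ∈ T) (h : sigma T t = t) :
    Tendsto (mu T) (𝓝[T] t) (𝓝 0) := by
  refine tendsto_order.2 ⟨fun ε hε => Eventually.of_forall fun s => hε.trans_le (mu_nonneg hub s),
    fun ε hε => ?_⟩
  obtain ⟨r, hr, htr, hrε, -⟩ := exists_right hub h (p := fun _ => True)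
    (Eventually.of_forall fun _ => trivial) (lt_add_of_pos_right t hε)
  filter_upwards [self_mem_nhdsWithin, mem_nhdsWithin_of_mem_nhds (Iio_mem_nhds htr),
    mem_nhdsWithin_of_mem_nhds (Ioi_mem_nhds (sub_lt_self t hε))] with s hs h1 h2
  rw [mu]
  have h3 : t - ε < s := h2
  rcases lt_or_ge s t with hst | hst
  · have := sigma_le ht hst
    linarith
  · have := sigma_le hr h1
    linarith

/-- Boundedness of `A` suffices since `m → 0`; the inverse is adjugate over determinant, both
continuous. -/
lemma tendsto_inv_one_add_smul {l : Filter ℝ} {m : ℝ → ℝ} (hm : Tendsto m l (𝓝 0))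
    (hA : ∀ i j, ∃ C, ∀ᶠ s in l, |A s i j| ≤ C) :
    Tendsto (fun s => (1 + m s • A s)⁻¹) l (𝓝 1) := by
  have h1 : Tendsto (fun s => 1 + m s • A s) l (𝓝 1) := by
    refine tendsto_pi_nhds.2 fun i => tendsto_pi_nhds.2 fun j => ?_
    obtain ⟨C, hC⟩ := hA i j
    have h2 : Tendsto (fun s => m s * A s i j) l (𝓝 0) := by
      refine hm.zero_mul_isBoundedUnder_le ?_
      exact ⟨C, Filter.eventually_map.2 hC⟩
    simpa using h2.const_add ((1 : Matrix (Fin n) (Fin n) ℝ) i j)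
  have h2 : Tendsto (fun s => (1 + m s • A s).det) l (𝓝 1) := by
    have := (Continuous.matrix_det continuous_id).tendsto (1 : Matrix (Fin n) (Fin n) ℝ)
    rw [id, Matrix.det_one] at this
    exact this.comp h1
  have h3 : Tendsto (fun s => (1 + m s • A s).adjugate) l (𝓝 1) := by
    have := (Continuous.matrix_adjugate continuous_id).tendsto (1 : Matrix (Fin n) (Fin n) ℝ)
    rw [id, Matrix.adjugate_one] at this
    exact this.comp h1
  simpa [Matrix.inv_def] using (h2.inv₀ one_ne_zero).smul h3

/-- Makes the coefficient `A (I + μA)⁻¹` of the adjoint equation admissible for the Picard series.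
-/
lemma weaklyRd_inv_one_add_mu_smul (hub : ¬ BddAbove T)
    (hA : ∀ i j, WeaklyRd T fun s => A s i j) (i j : Fin n) :
    WeaklyRd T fun s => (1 + mu T s • A s)⁻¹ i j := by
  have happly : ∀ {l : Filter ℝ}, Tendsto (fun s => (1 + mu T s • A s)⁻¹) l (𝓝 1) →
      Tendsto (fun s => (1 + mu T s • A s)⁻¹ i j) l (𝓝 ((1 : Matrix (Fin n) (Fin n) ℝ) i j)) :=
    fun h => tendsto_pi_nhds.1 (tendsto_pi_nhds.1 h i) j
  have hdense : ∀ t ∈ T, sigma T t = t → Tendsto (fun s => (1 + mu T s • A s)⁻¹ i j) (𝓝[T] t)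
      (𝓝 ((1 : Matrix (Fin n) (Fin n) ℝ) i j)) := fun t ht h =>
    happly (tendsto_inv_one_add_smul (tendsto_mu_rightDense hub ht h)
      fun i j => (hA i j).bounded t ht)
  refine ⟨fun t ht h => ?_, fun t ht => ?_⟩
  · have hmu : mu T t = 0 := by rw [mu, h, sub_self]
    simpa [ContinuousWithinAt, hmu] using hdense t ht h
  · rcases (le_sigma hub t).eq_or_lt with heq | hlt
    · exact ⟨_, Tendsto.eventually_abs_le (hdense t ht heq.symm)⟩
    · have hl := happly (tendsto_inv_one_add_smul (tendsto_mu_left hub ht) fun i j =>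
        ((hA i j).bounded t ht).imp fun C hC =>
          hC.filter_mono (nhdsWithin_mono _ Set.inter_subset_left))
      refine ⟨max (|(1 : Matrix (Fin n) (Fin n) ℝ) i j| + 1) |(1 + mu T t • A t)⁻¹ i j|, Filter.Eventually.filter_mono
        (nhdsWithin_le_of_rightScattered hlt) (eventually_sup.2 ⟨?_, ?_⟩)⟩
      · exact (Tendsto.eventually_abs_le hl).mono fun s hs => hs.trans (le_max_left _ _)
      · exact eventually_pure.2 (le_max_right _ _)

lemma WeaklyRd.inter_Ici {f : ℝ → ℝ} (hf : WeaklyRd T f) (a : ℝ) :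
    WeaklyRd (T ∩ Set.Ici a) f := by
  refine ⟨fun t ht h => ?_, fun t ht => ?_⟩
  · rw [sigma_inter_Ici a ht.2] at h
    exact (hf.continuous t ht.1 h).mono Set.inter_subset_left
  · obtain ⟨C, hC⟩ := hf.bounded t ht.1
    exact ⟨C, hC.filter_mono (nhdsWithin_mono _ Set.inter_subset_left)⟩

/-- `X` is an invertible solution of `X^Δ = A X` whose inverse solves the adjoint equation. -/
structure IsFundamental (T : Set ℝ) (A X : ℝ → Matrix (Fin n) (Fin n) ℝ) : Prop where
  isUnit : ∀ t ∈ T, IsUnit (X t).det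
  deriv : ∀ t ∈ T, MatHasDeltaDerivAt T X (A t * X t) t
  deriv_inv : ∀ t ∈ T, MatHasDeltaDerivAt T (fun s => (X s)⁻¹)
    (-((X t)⁻¹ * (A t * (1 + mu T t • A t)⁻¹))) t

/-- In `(Y Z)^Δ` the factor `Z(σ(t)) = (I + μA) Z(t)` cancels the inverse in the adjoint equation,
so the derivative is zero. -/
lemma mul_eq_of_adjoint (hT : IsClosed T) (hub : ¬ BddAbove T) (hreg : IsRegressive T A)
    {Y : ℝ → Matrix (Fin n) (Fin n) ℝ} (hZ : ∀ t ∈ T, MatHasDeltaDerivAt T Z (A t * Z t) t)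
    (hY : ∀ t ∈ T, MatHasDeltaDerivAt T Y (-(Y t * (A t * (1 + mu T t • A t)⁻¹))) t)
    {s t : ℝ} (hs : s ∈ T) (ht : t ∈ T) : Y s * Z s = Y t * Z t := by
  refine eq_of_matDeriv_zero (F := fun s => Y s * Z s) hT hub (fun t ht => ?_) hs ht
  have h := (hY t ht).mul (hZ t ht) ht
  have hR : (1 + mu T t • A t)⁻¹ * (1 + mu T t • A t) = 1 :=
    Matrix.nonsing_inv_mul _ ((Matrix.isUnit_iff_isUnit_det _).1 (hreg t ht))
  have hσ : Z (sigma T t) = (1 + mu T t • A t) * Z t := by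
    rw [(hZ t ht).apply_sigma ht, add_mul, one_mul, smul_mul_assoc]
  have h0 : -(Y t * (A t * (1 + mu T t • A t)⁻¹)) * Z (sigma T t) + Y t * (A t * Z t) = 0 := by
    have : Y t * (A t * (1 + mu T t • A t)⁻¹) * Z (sigma T t) =
        Y t * A t * ((1 + mu T t • A t)⁻¹ * (1 + mu T t • A t)) * Z t := by
      rw [hσ]; noncomm_ring
    rw [neg_mul, this, hR, mul_one, mul_assoc, neg_add_cancel]
  rwa [h0] at h

/-- Since `X⁻¹ Z` is constant on `T`, uniqueness holds to both sides of `t₀` and needs no Gronwall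
estimate. -/
lemma IsFundamental.eq_of_solution (hX : IsFundamental T A X) (hT : IsClosed T)
    (hub : ¬ BddAbove T) (hreg : IsRegressive T A)
    (hZ : ∀ t ∈ T, MatHasDeltaDerivAt T Z (A t * Z t) t) (ht₀ : t₀ ∈ T) (ht : t ∈ T) :
    Z t = X t * (X t₀)⁻¹ * Z t₀ := by
  have h := mul_eq_of_adjoint hT hub hreg hZ hX.deriv_inv ht ht₀
  rw [mul_assoc, ← h, Matrix.mul_nonsing_inv_cancel_left _ _ (hX.isUnit t ht)]

/-- The transposed adjoint equation is solved forward from `a`. Its transposed solution is a left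
inverse of `X`, and right multiplication by the constant `(Z t₀)ᵀ` normalises at `t₀`. -/
lemma exists_fundamental_of_least (hT : IsClosed T) (hub : ¬ BddAbove T) (ha : a ∈ T)
    (hmin : ∀ s ∈ T, a ≤ s) (hA : ∀ i j, WeaklyRd T fun s => A s i j)
    (hreg : IsRegressive T A) (ht₀ : t₀ ∈ T) : ∃ X, IsFundamental T A X ∧ X t₀ = 1 := by
  obtain ⟨X, hXa, hX⟩ := exists_solution_of_least hT hub ha hmin hA
  obtain ⟨Z, hZa, hZ⟩ := exists_solution_of_least (A := fun s => -(A s * (1 + mu T s • A s)⁻¹)ᵀ)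
    hT hub ha hmin (fun i j => by
      have := weaklyRd_mul_apply hA (weaklyRd_inv_one_add_mu_smul hub hA) j i
      simpa [-Matrix.transpose_mul] using (WeaklyRd.const T (-1)).mul this)
  have hY : ∀ t ∈ T, MatHasDeltaDerivAt T (fun s => (Z s)ᵀ)
      (-((Z t)ᵀ * (A t * (1 + mu T t • A t)⁻¹))) t := fun t ht => by
    have := (hZ t ht).transpose
    rwa [Matrix.transpose_mul, Matrix.transpose_neg, Matrix.transpose_transpose, mul_neg] at this
  have hYX : ∀ t ∈ T, (Z t)ᵀ * X t = 1 := fun t ht => by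
    have := mul_eq_of_adjoint hT hub hreg hX hY ht ha
    rwa [hXa, hZa, Matrix.transpose_one, one_mul] at this
  have hinv : ∀ t ∈ T, (X t * (Z t₀)ᵀ)⁻¹ = X t₀ * (Z t)ᵀ := fun t ht => by
    refine Matrix.inv_eq_left_inv ?_
    rw [mul_assoc, ← mul_assoc _ (X t), hYX t ht, one_mul, mul_eq_one_comm, hYX t₀ ht₀]
  refine ⟨fun t => X t * (Z t₀)ᵀ, ⟨fun t ht => ?_, fun t ht => ?_, fun t ht => ?_⟩, ?_⟩
  · rw [Matrix.det_mul]
    have h : ∀ t ∈ T, (Z t).det * (X t).det = 1 := fun t ht => by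
      rw [← Matrix.det_transpose (Z t), ← Matrix.det_mul, hYX t ht, Matrix.det_one]
    refine (IsUnit.of_mul_eq_one_right _ (h t ht)).mul ?_
    rw [Matrix.det_transpose]
    exact IsUnit.of_mul_eq_one _ (h t₀ ht₀)
  · have := (hX t ht).mul (MatHasDeltaDerivAt.const T (Z t₀)ᵀ t) ht
    rwa [mul_zero, add_zero, mul_assoc] at this
  · have := ((MatHasDeltaDerivAt.const T (X t₀) t).mul (hY t ht) ht).congr
      (sigma_mem hT hub t) hinv
    rwa [zero_mul, zero_add, mul_neg, ← mul_assoc, ← hinv t ht] at this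
  · exact mul_eq_one_comm.1 (hYX t₀ ht₀)

/-- Existence of a fundamental matrix on a time scale that is unbounded above. -/
lemma exists_fundamental (hT : IsClosed T) (hub : ¬ BddAbove T)
    (hA : ∀ i j, WeaklyRd T fun s => A s i j) (hreg : IsRegressive T A) (ht₀ : t₀ ∈ T) :
    ∃ X, IsFundamental T A X ∧ X t₀ = 1 := by
  have hTa : ∀ a, IsClosed (T ∩ Set.Ici a) := fun a => hT.inter isClosed_Ici
  have huba := not_bddAbove_inter_Ici hub
  have hrega : ∀ a, IsRegressive (T ∩ Set.Ici a) A := fun a t ht => by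
    rw [mu_inter_Ici a ht.2]
    exact hreg t ht.1
  -- `T` may have no least element, so a solution is chosen on every truncation with `a ≤ t₀`; for
  -- other `a` the value is irrelevant.
  have hex : ∀ a : ℝ, ∃ X : ℝ → Matrix (Fin n) (Fin n) ℝ, a ∈ T → a ≤ t₀ →
      IsFundamental (T ∩ Set.Ici a) A X ∧ X t₀ = 1 := fun a => by
    by_cases ha : a ∈ T ∧ a ≤ t₀
    · obtain ⟨X, hX⟩ := exists_fundamental_of_least (hTa a) (huba a) ⟨ha.1, Set.self_mem_Ici⟩
        (fun s hs => hs.2) (fun i j => (hA i j).inter_Ici a) (hrega a) ⟨ht₀, ha.2⟩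
      exact ⟨X, fun _ _ => hX⟩
    · exact ⟨fun _ => 1, fun h1 h2 => absurd ⟨h1, h2⟩ ha⟩
  choose X hX using hex
  have hmin : ∀ t ∈ T, min t t₀ ∈ T := fun t ht => by
    rcases min_choice t t₀ with h | h <;> rw [h] <;> assumption
  have hagree : ∀ a ∈ T, a ≤ t₀ → ∀ s ∈ T ∩ Set.Ici a, X (min s t₀) s = X a s := by
    intro a ha hat₀ s hs
    have hm := hmin s hs.1
    have ham : a ≤ min s t₀ := le_min hs.2 hat₀
    have h1 := hX _ hm (min_le_right _ _)
    have h2 := hX a ha hat₀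
    have h3 : ∀ t ∈ T ∩ Set.Ici (min s t₀),
        MatHasDeltaDerivAt (T ∩ Set.Ici (min s t₀)) (X a) (A t * X a t) t := fun t ht => by
      have h4 := (h2.1.deriv t ⟨ht.1, ham.trans ht.2⟩).inter_Ici (a := min s t₀) ht.2
      rwa [Set.inter_assoc, Set.Ici_inter_Ici, max_eq_right ham] at h4
    have h5 := h1.1.eq_of_solution (hTa _) (huba _) (hrega _) h3
      (t₀ := t₀) (t := s) ⟨ht₀, min_le_right s t₀⟩ ⟨hs.1, min_le_left s t₀⟩
    rw [h5, h1.2, h2.2, inv_one, mul_one, mul_one]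
  -- Each `t` needs a truncation agreeing with `T` near it. If no point of `T` lies below `min t
  -- t₀`, that minimum is the least element.
  have hlocal : ∀ t ∈ T, ∃ a ∈ T, a ≤ t₀ ∧ a ≤ t ∧ (a < t ∨ ∀ s ∈ T, a ≤ s) := by
    intro t ht
    by_cases h : ∃ a ∈ T, a < min t t₀
    · obtain ⟨a, ha, h⟩ := h
      have := lt_min_iff.1 h
      exact ⟨a, ha, this.2.le, this.1.le, Or.inl this.1⟩
    · push Not at h
      exact ⟨min t t₀, hmin t ht, min_le_right _ _, min_le_left _ _, Or.inr h⟩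
  refine ⟨fun t => X (min t t₀) t, ⟨fun t ht => ?_, fun t ht => ?_, fun t ht => ?_⟩, ?_⟩
  · exact (hX _ (hmin t ht) (min_le_right _ _)).1.isUnit t ⟨ht, min_le_left t t₀⟩
  · obtain ⟨a, ha, hat₀, hat, hloc⟩ := hlocal t ht
    rw [hagree a ha hat₀ t ⟨ht, hat⟩]
    exact (((hX a ha hat₀).1.deriv t ⟨ht, hat⟩).congr (sigma_mem (hTa a) (huba a) t)
      (hagree a ha hat₀)).of_inter_Ici hat hloc
  · obtain ⟨a, ha, hat₀, hat, hloc⟩ := hlocal t ht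
    rw [hagree a ha hat₀ t ⟨ht, hat⟩, ← mu_inter_Ici a hat]
    exact (((hX a ha hat₀).1.deriv_inv t ⟨ht, hat⟩).congr (sigma_mem (hTa a) (huba a) t)
      fun s hs => by rw [hagree a ha hat₀ s hs]).of_inter_Ici hat hloc
  · change X (min t₀ t₀) t₀ = 1
    rw [min_self]
    exact (hX t₀ ht₀ le_rfl).2

lemma IsFundamental.unique (hX : IsFundamental T A X) (hT : IsClosed T) (hub : ¬ BddAbove T)
    (hreg : IsRegressive T A) (hX₀ : X t₀ = 1) (ht₀ : t₀ ∈ T) (hZ : SolvesMatrixIVP T A t₀ Z)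
    (ht : t ∈ T) : Z t = X t := by
  rw [hX.eq_of_solution hT hub hreg hZ.2 ht₀ ht, hX₀, hZ.1, inv_one, mul_one, mul_one]

lemma transitionMatrix_solves (hT : IsClosed T) (hub : ¬ BddAbove T)
    (hA : ∀ i j, WeaklyRd T fun s => A s i j) (hreg : IsRegressive T A) (ht₀ : t₀ ∈ T) :
    SolvesMatrixIVP T A t₀ fun s => transitionMatrix T A s t₀ := by
  obtain ⟨X, hX, hX₀⟩ := exists_fundamental hT hub hA hreg ht₀
  exact Classical.epsilon_spec (p := SolvesMatrixIVP T A t₀) ⟨X, hX₀, hX.deriv⟩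

/-- The `epsilon` choice is only known to solve the initial value problem; uniqueness on `T`
identifies it there with a fundamental matrix. -/
lemma transitionMatrix_fundamental (hT : IsClosed T) (hub : ¬ BddAbove T)
    (hA : ∀ i j, WeaklyRd T fun s => A s i j) (hreg : IsRegressive T A) (ht₀ : t₀ ∈ T) :
    IsFundamental T A fun s => transitionMatrix T A s t₀ := by
  obtain ⟨X, hX, hX₀⟩ := exists_fundamental hT hub hA hreg ht₀
  have hs := transitionMatrix_solves hT hub hA hreg ht₀
  have heq : ∀ s ∈ T, transitionMatrix T A s t₀ = X s := fun s h =>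
    hX.unique hT hub hreg hX₀ ht₀ hs h
  refine ⟨fun t ht => ?_, hs.2, fun t ht => ?_⟩
  · rw [heq t ht]
    exact hX.isUnit t ht
  · rw [heq t ht]
    exact (hX.deriv_inv t ht).congr (sigma_mem hT hub t) fun s h => by rw [heq s h]

/-- The cocycle property of the transition matrix. -/
lemma transitionMatrix_eq_mul_inv (hT : IsClosed T) (hub : ¬ BddAbove T)
    (hA : ∀ i j, WeaklyRd T fun s => A s i j) (hreg : IsRegressive T A) (ht₀ : t₀ ∈ T)
    {s t : ℝ} (hs : s ∈ T) (ht : t ∈ T) :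
    transitionMatrix T A s t = transitionMatrix T A s t₀ * (transitionMatrix T A t t₀)⁻¹ := by
  have h := transitionMatrix_solves hT hub hA hreg ht
  have h1 : transitionMatrix T A t t = 1 := h.1
  have h2 := (transitionMatrix_fundamental hT hub hA hreg ht₀).eq_of_solution hT hub hreg h.2 ht hs
  rwa [h1, mul_one] at h2

end Fundamental

end TimeScale

namespace TimeScale

/-! ### The Lyapunov equation -/

section Lyapunov

variable {n : ℕ} {T : Set ℝ} {t : ℝ} {A M P X : ℝ → Matrix (Fin n) (Fin n) ℝ}
  {D : Matrix (Fin n) (Fin n) ℝ}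

/-- The left hand side of the Lyapunov equation at `t`, for the value `D` of `P^Δ(t)`. -/
noncomputable def lyapunovLHS (T : Set ℝ) (A P : ℝ → Matrix (Fin n) (Fin n) ℝ) (D : Matrix (Fin n) (Fin n) ℝ)
    (t : ℝ) : Matrix (Fin n) (Fin n) ℝ :=
  (A t)ᵀ * P t + P t * A t + mu T t • ((A t)ᵀ * P t * A t)
    + (1 + mu T t • (A t)ᵀ) * D * (1 + mu T t • A t)

/-- The delta derivative of `Xᵀ P X` for a solution `X` of `X^Δ = A X`. -/
lemma hasDeltaDerivAt_conj (ht : t ∈ T) (hX : MatHasDeltaDerivAt T X (A t * X t) t)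
    (hP : MatHasDeltaDerivAt T P D t) :
    MatHasDeltaDerivAt T (fun s => (X s)ᵀ * P s * X s)
      ((X t)ᵀ * lyapunovLHS T A P D t * X t) t := by
  have h1 := hP.mul hX ht
  have h2 := hX.transpose.mul h1 ht
  simp only [← mul_assoc] at h2
  convert h2 using 1
  -- Expanding the product `P X` at `σ(t)` as a whole avoids a separate expansion of `P(σ(t))`.
  have hσ := h1.apply_sigma ht
  rw [mul_assoc _ (P (sigma T t)), hσ, hX.apply_sigma ht, lyapunovLHS, Matrix.transpose_mul]
  simp only [mul_add, add_mul, smul_mul_assoc, mul_smul_comm, mul_assoc, mul_one, one_mul,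
    smul_add]
  abel

/-- The delta derivative of `xᵀ P x` for a solution `x` of `x^Δ = A x`. -/
lemma hasDeltaDerivAt_quadForm {x : ℝ → Fin n → ℝ} (ht : t ∈ T)
    (hx : VecHasDeltaDerivAt T x (A t *ᵥ x t) t) (hP : MatHasDeltaDerivAt T P D t) :
    HasDeltaDerivAt T (fun s => x s ⬝ᵥ (P s *ᵥ x s)) (x t ⬝ᵥ (lyapunovLHS T A P D t *ᵥ x t)) t := by
  have h1 := hP.mulVec hx ht
  have h2 := hx.dotProduct h1 ht
  convert h2 using 1
  have hσ := h1.apply_sigma ht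
  have hA : ∀ v, (A t *ᵥ x t) ⬝ᵥ v = x t ⬝ᵥ ((A t)ᵀ *ᵥ v) := fun v => by
    rw [Matrix.dotProduct_mulVec, Matrix.vecMul_transpose]
  rw [hσ, hx.apply_sigma ht, hA, lyapunovLHS, ← dotProduct_add]
  congr 1
  simp only [Matrix.add_mulVec, Matrix.mulVec_add, Matrix.smul_mulVec, Matrix.mulVec_smul,
    Matrix.one_mulVec, smul_add, ← Matrix.mulVec_mulVec]
  abel

lemma SolvesTSDLE.hasDeltaDerivAt_conj (hP : SolvesTSDLE T A M P) (ht : t ∈ T)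
    (hX : MatHasDeltaDerivAt T X (A t * X t) t) :
    MatHasDeltaDerivAt T (fun s => (X s)ᵀ * P s * X s) (-((X t)ᵀ * M t * X t)) t := by
  obtain ⟨D, hD, h⟩ := hP t ht
  have h1 := TimeScale.hasDeltaDerivAt_conj ht hX hD
  rwa [show lyapunovLHS T A P D t = -M t from h, mul_neg, neg_mul] at h1

lemma SolvesTSDLE.hasDeltaDerivAt_quadForm (hP : SolvesTSDLE T A M P) {x : ℝ → Fin n → ℝ}
    (ht : t ∈ T) (hx : VecHasDeltaDerivAt T x (A t *ᵥ x t) t) :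
    HasDeltaDerivAt T (fun s => x s ⬝ᵥ (P s *ᵥ x s)) (-(x t ⬝ᵥ (M t *ᵥ x t))) t := by
  obtain ⟨D, hD, h⟩ := hP t ht
  have h1 := TimeScale.hasDeltaDerivAt_quadForm ht hx hD
  rwa [show lyapunovLHS T A P D t = -M t from h, Matrix.neg_mulVec, dotProduct_neg] at h1

lemma weaklyRd_conj (hX : ∀ t ∈ T, MatHasDeltaDerivAt T X (A t * X t) t)
    (hM : ∀ i j, WeaklyRd T fun s => M s i j) (i j : Fin n) :
    WeaklyRd T fun s => ((X s)ᵀ * M s * X s) i j := by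
  have hXc : ∀ i j, WeaklyRd T fun s => X s i j := fun i j =>
    ContinuousOn.weaklyRd fun t ht => (hX t ht i j).continuousWithinAt ht
  exact weaklyRd_mul_apply (weaklyRd_mul_apply (fun i j => hXc j i) hM) hXc i j

variable {t₀ : ℝ}

/-- Conservation law for the Lyapunov equation. -/
lemma SolvesTSDLE.conj_eq (hT : IsClosed T) (hub : ¬ BddAbove T)
    (hM : ∀ i j, WeaklyRd T fun s => M s i j)
    (hX : ∀ t ∈ T, MatHasDeltaDerivAt T X (A t * X t) t) (hP : SolvesTSDLE T A M P)
    (ht₀ : t₀ ∈ T) (ht : t ∈ T) :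
    (X t)ᵀ * P t * X t =
      (X t₀)ᵀ * P t₀ * X t₀ - matDeltaIntegral T (fun s => (X s)ᵀ * M s * X s) t₀ t := by
  have h := eq_of_matDeriv_zero (T := T)
    (F := fun t => (X t)ᵀ * P t * X t + matDeltaIntegral T (fun s => (X s)ᵀ * M s * X s) t₀ t)
    hT hub (fun t ht => by
      have := (hP.hasDeltaDerivAt_conj ht (hX t ht)).add
        (matHasDeltaDerivAt_integral hT hub (weaklyRd_conj hX hM) ht₀ ht)
      rwa [neg_add_cancel] at this) ht ht₀
  rw [matDeltaIntegral_self, add_zero] at h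
  exact eq_sub_of_add_eq h

lemma inv_conj_cancel {X : Matrix (Fin n) (Fin n) ℝ} (hX : IsUnit X.det)
    (Q : Matrix (Fin n) (Fin n) ℝ) : (Xᵀ)⁻¹ * (Xᵀ * Q * X) * X⁻¹ = Q := by
  have hXt : IsUnit (Xᵀ).det := by rwa [Matrix.det_transpose]
  rw [mul_assoc Xᵀ, Matrix.nonsing_inv_mul_cancel_left _ _ hXt,
    Matrix.mul_nonsing_inv_cancel_right _ _ hX]

lemma conj_inv_cancel {X : Matrix (Fin n) (Fin n) ℝ} (hX : IsUnit X.det)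
    (Q : Matrix (Fin n) (Fin n) ℝ) : Xᵀ * ((Xᵀ)⁻¹ * Q * X⁻¹) * X = Q := by
  have hXt : IsUnit (Xᵀ).det := by rwa [Matrix.det_transpose]
  rw [mul_assoc (Xᵀ)⁻¹, Matrix.mul_nonsing_inv_cancel_left _ _ hXt,
    Matrix.nonsing_inv_mul_cancel_right _ _ hX]

/-- Existence of a solution of the Lyapunov equation. -/
lemma exists_solvesTSDLE (hT : IsClosed T) (hub : ¬ BddAbove T)
    (hM : ∀ i j, WeaklyRd T fun s => M s i j) (hX : IsFundamental T A X) (ht₀ : t₀ ∈ T)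
    (hX₀ : X t₀ = 1) (P₀ : Matrix (Fin n) (Fin n) ℝ) :
    ∃ P, SolvesTSDLE T A M P ∧ P t₀ = P₀ := by
  -- `Q` is the value that the conservation law forces on `Xᵀ P X`.
  let Q : ℝ → Matrix (Fin n) (Fin n) ℝ := fun t =>
    P₀ - matDeltaIntegral T (fun s => (X s)ᵀ * M s * X s) t₀ t
  have hQ : ∀ t ∈ T, MatHasDeltaDerivAt T Q (-((X t)ᵀ * M t * X t)) t := fun t ht => by
    have := (MatHasDeltaDerivAt.const T P₀ t).sub
      (matHasDeltaDerivAt_integral hT hub (weaklyRd_conj hX.deriv hM) ht₀ ht)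
    rwa [zero_sub] at this
  refine ⟨fun t => ((X t)⁻¹)ᵀ * Q t * (X t)⁻¹, fun t ht => ?_, ?_⟩
  · have hP := ((hX.deriv_inv t ht).transpose.mul (hQ t ht) ht).mul (hX.deriv_inv t ht) ht
    refine ⟨_, hP, ?_⟩
    -- The formula for `P^Δ` is never simplified: `Xᵀ P X = Q` is differentiated in two ways, and
    -- uniqueness of the derivative gives the equation after cancelling `X`.
    have h1 := hasDeltaDerivAt_conj ht (hX.deriv t ht) hP
    have h2 := ((hQ t ht).congr (sigma_mem hT hub t) fun s hs => by
      have := conj_inv_cancel (hX.isUnit s hs) (Q s)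
      rwa [← Matrix.transpose_nonsing_inv] at this).unique hub ht h1
    have h3 := inv_conj_cancel (hX.isUnit t ht) (-M t)
    rw [mul_neg (X t)ᵀ, neg_mul, h2, inv_conj_cancel (hX.isUnit t ht)] at h3
    exact h3
  · simp [Q, hX₀, matDeltaIntegral_self]

/-! ### Behaviour at infinity and positivity -/

lemma neBot_atTop_inf_principal (hub : ¬ BddAbove T) : (atTop ⊓ 𝓟 T : Filter ℝ).NeBot := by
  rw [← frequently_mem_iff_neBot, frequently_atTop]
  intro a
  obtain ⟨b, hb, h⟩ := not_bddAbove_iff.1 hub a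
  exact ⟨b, h.le, hb⟩

/-- By the conservation law, `Xᵀ P X` at `b` is `P(t₀)` minus the integral up to `b`, that is, the
tail of a convergent integral. -/
lemma tendsto_conj_zero (hT : IsClosed T) (hub : ¬ BddAbove T)
    (hM : ∀ i j, WeaklyRd T fun s => M s i j)
    (hX : ∀ t ∈ T, MatHasDeltaDerivAt T X (A t * X t) t) (hP : SolvesTSDLE T A M P)
    (ht₀ : t₀ ∈ T) (hX₀ : X t₀ = 1)
    (hP₀ : HasImproperDeltaIntegral T (fun s => (X s)ᵀ * M s * X s) t₀ (P t₀)) :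
    Tendsto (fun b => (X b)ᵀ * P b * X b) (atTop ⊓ 𝓟 T) (𝓝 0) := by
  have h : Tendsto (fun b => matDeltaIntegral T (fun s => (X s)ᵀ * M s * X s) t₀ b)
      (atTop ⊓ 𝓟 T) (𝓝 (P t₀)) :=
    tendsto_pi_nhds.2 fun i => tendsto_pi_nhds.2 fun j => hP₀ i j
  have h1 := h.const_sub (P t₀)
  rw [sub_self] at h1
  refine h1.congr' ?_
  filter_upwards [mem_inf_of_right (mem_principal_self T)] with b hb
  rw [hP.conj_eq hT hub hM hX ht₀ hb, hX₀, Matrix.transpose_one, one_mul, mul_one]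

lemma hasImproperDeltaIntegral_of_tendsto (hT : IsClosed T) (hub : ¬ BddAbove T)
    (hM : ∀ i j, WeaklyRd T fun s => M s i j)
    (hX : ∀ t ∈ T, MatHasDeltaDerivAt T X (A t * X t) t) (hP : SolvesTSDLE T A M P)
    (ht : t ∈ T) (hXt : X t = 1)
    (hlim : Tendsto (fun b => (X b)ᵀ * P b * X b) (atTop ⊓ 𝓟 T) (𝓝 0)) :
    HasImproperDeltaIntegral T (fun s => (X s)ᵀ * M s * X s) t (P t) := by
  have h1 := hlim.const_sub (P t)
  rw [sub_zero] at h1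
  have h2 : Tendsto (fun b => matDeltaIntegral T (fun s => (X s)ᵀ * M s * X s) t b)
      (atTop ⊓ 𝓟 T) (𝓝 (P t)) := by
    refine h1.congr' ?_
    filter_upwards [mem_inf_of_right (mem_principal_self T)] with b hb
    rw [hP.conj_eq hT hub hM hX ht hb, hXt, Matrix.transpose_one, one_mul, mul_one, sub_sub_cancel]
  exact fun i j => tendsto_pi_nhds.1 (tendsto_pi_nhds.1 h2 i) j

lemma posDef_of_tendsto (hT : IsClosed T) (hub : ¬ BddAbove T) (hX : IsFundamental T A X)
    (hP : SolvesTSDLE T A M P) (hMpos : ∀ t ∈ T, (M t).PosDef) (ht : t ∈ T) (hXt : X t = 1)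
    (hlim : Tendsto (fun b => (X b)ᵀ * P b * X b) (atTop ⊓ 𝓟 T) (𝓝 0)) : (P t).PosDef := by
  have hne := neBot_atTop_inf_principal hub
  have hval : (X t)ᵀ * P t * X t = P t := by
    rw [hXt, Matrix.transpose_one, one_mul, mul_one]
  have hQ := fun s hs => hP.hasDeltaDerivAt_conj (t := s) hs (hX.deriv s hs)
  have hMT : ∀ s ∈ T, (M s)ᵀ = M s := fun s hs => by
    simpa [Matrix.IsHermitian, Matrix.conjTranspose_eq_transpose_of_trivial] using (hMpos s hs).1
  refine Matrix.PosDef.of_dotProduct_mulVec_pos ?_ fun x hx => ?_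
  · rw [Matrix.IsHermitian, Matrix.conjTranspose_eq_transpose_of_trivial]
    -- Symmetry of `M` makes the antisymmetric part of `Xᵀ P X` constant; its limit is `0`, so it
    -- vanishes.
    have hconst : ∀ b ∈ T, (X b)ᵀ * P b * X b - ((X b)ᵀ * P b * X b)ᵀ = P t - (P t)ᵀ := by
      intro b hb
      have h := eq_of_matDeriv_zero (F := fun b => (X b)ᵀ * P b * X b - ((X b)ᵀ * P b * X b)ᵀ)
        hT hub (fun s hs => by
          have := (hQ s hs).sub (hQ s hs).transpose
          rwa [Matrix.transpose_neg, Matrix.transpose_mul, Matrix.transpose_mul,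
            Matrix.transpose_transpose, hMT s hs, mul_assoc, sub_self] at this) hb ht
      rwa [hval] at h
    have h1 := hlim.sub ((Continuous.matrix_transpose continuous_id).tendsto
      (0 : Matrix (Fin n) (Fin n) ℝ) |>.comp hlim)
    have h2 : P t - (P t)ᵀ = 0 := by
      refine tendsto_nhds_unique (tendsto_const_nhds.congr' ?_) (h1.trans (by simp))
      filter_upwards [mem_inf_of_right (mem_principal_self T)] with b hb
      exact (hconst b hb).symm
    exact (sub_eq_zero.1 h2).symm
  · have hderiv := fun s hs => (hQ s hs).quadForm x
    have hneg : ∀ s ∈ T, x ⬝ᵥ (-((X s)ᵀ * M s * X s) *ᵥ x) < 0 := fun s hs => by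
      have hXx : X s *ᵥ x ≠ 0 := fun h => hx <| by
        rw [← Matrix.one_mulVec x, ← Matrix.nonsing_inv_mul _ (hX.isUnit s hs),
          ← Matrix.mulVec_mulVec, h, Matrix.mulVec_zero]
      have := (hMpos s hs).dotProduct_mulVec_pos hXx
      rw [star_trivial] at this
      rw [Matrix.neg_mulVec, dotProduct_neg, ← Matrix.mulVec_mulVec, ← Matrix.mulVec_mulVec,
        Matrix.dotProduct_mulVec, Matrix.vecMul_transpose]
      linarith
    have hanti := antitoneOn_of_deriv_nonpos hT hub
      fun s hs => ⟨_, (hneg s hs).le, hderiv s hs⟩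
    -- Monotonicity with limit `0` gives only nonnegativity; one strict drop after `t` makes the
    -- value at `t` positive.
    obtain ⟨s, hs, -, hlt⟩ := exists_lt_of_deriv_neg hT hub ht (hderiv t ht) (hneg t ht)
    have hcont : Continuous fun Q : Matrix (Fin n) (Fin n) ℝ => x ⬝ᵥ (Q *ᵥ x) := by
      fun_prop
    have h0 : Tendsto (fun b => x ⬝ᵥ (((X b)ᵀ * P b * X b) *ᵥ x)) (atTop ⊓ 𝓟 T) (𝓝 0) := by
      have := (hcont.tendsto 0).comp hlim
      rwa [Matrix.zero_mulVec, dotProduct_zero] at this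
    have h1 : 0 ≤ x ⬝ᵥ (((X s)ᵀ * P s * X s) *ᵥ x) := by
      refine le_of_tendsto h0 ?_
      filter_upwards [mem_inf_of_right (mem_principal_self T),
        mem_inf_of_left (eventually_ge_atTop s)] with b hb hsb
      exact hanti hs hb hsb
    rw [hval] at hlt
    rw [star_trivial]
    exact h1.trans_lt hlt

/-- A positive definite solution of the Lyapunov equation gives a Lyapunov function. -/
lemma isLyapunovFunction_quadForm (hP : SolvesTSDLE T A M P) (hMpos : ∀ t ∈ T, (M t).PosDef)
    (hpos : ∀ t ∈ T, (P t).PosDef) : IsLyapunovFunction T A fun t x => x ⬝ᵥ (P t *ᵥ x) where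
  nonneg t ht x := by simpa using (hpos t ht).posSemidef.dotProduct_mulVec_nonneg x
  eq_zero_iff t ht x := by
    refine ⟨fun h => by_contra fun hx => ?_, fun h => by simp [h]⟩
    have := (hpos t ht).dotProduct_mulVec_pos hx
    rw [star_trivial, h] at this
    exact lt_irrefl _ this
  deriv_nonpos x hx t ht := by
    refine ⟨_, hP.hasDeltaDerivAt_quadForm ht (hx t ht), ?_⟩
    have := (hMpos t ht).posSemidef.dotProduct_mulVec_nonneg (x t)
    rw [star_trivial] at this
    linarith

end Lyapunov

end TimeScale

/-! ### The main theorem -/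

theorem mainTheorem2 {n : ℕ} (T : Set ℝ) (hT : TimeScale.IsTimeScale T) (hub : ¬ BddAbove T)
    (A M : ℝ → Matrix (Fin n) (Fin n) ℝ)
    (hA : TimeScale.MatRdContinuous T A) (hreg : TimeScale.IsRegressive T A)
    (hM : TimeScale.MatRdContinuous T M)
    (t₀ : ℝ) (ht₀ : t₀ ∈ T) (P₀ : Matrix (Fin n) (Fin n) ℝ)
    (hP₀ : TimeScale.HasImproperDeltaIntegral T
      (fun s => (TimeScale.transitionMatrix T A s t₀)ᵀ * M s * TimeScale.transitionMatrix T A s t₀)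
      t₀ P₀) :
    (∃ P : ℝ → Matrix (Fin n) (Fin n) ℝ, TimeScale.SolvesTSDLE T A M P ∧ P t₀ = P₀) ∧
    ∀ P : ℝ → Matrix (Fin n) (Fin n) ℝ, TimeScale.SolvesTSDLE T A M P → P t₀ = P₀ →
      (∀ t ∈ T, P t =
        ((TimeScale.transitionMatrix T A t t₀)ᵀ)⁻¹ * P₀ * (TimeScale.transitionMatrix T A t t₀)⁻¹
        - ((TimeScale.transitionMatrix T A t t₀)ᵀ)⁻¹
          * TimeScale.matDeltaIntegral T
              (fun s => (TimeScale.transitionMatrix T A s t₀)ᵀ * M s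
                * TimeScale.transitionMatrix T A s t₀) t₀ t
          * (TimeScale.transitionMatrix T A t t₀)⁻¹) ∧
      (∀ t ∈ T, TimeScale.HasImproperDeltaIntegral T
        (fun s => (TimeScale.transitionMatrix T A s t)ᵀ * M s * TimeScale.transitionMatrix T A s t)
        t (P t)) ∧
      ((∀ t ∈ T, (M t).PosDef) →
        (∀ t ∈ T, (P t).PosDef) ∧
        TimeScale.IsLyapunovFunction T A (fun t x => x ⬝ᵥ (P t *ᵥ x)) ∧
        ∀ x : ℝ → Fin n → ℝ, TimeScale.SolvesLinear T A x → ∀ t ∈ T, x t ≠ 0 →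
          ∃ d : ℝ, TimeScale.HasDeltaDerivAt T (fun s => x s ⬝ᵥ (P s *ᵥ x s)) d t ∧ d < 0) := by
  have hTc := hT.isClosed
  have hAw := fun i j => (hA i j).weaklyRd hub
  have hMw := fun i j => (hM i j).weaklyRd hub
  have hfund := fun t ht => TimeScale.transitionMatrix_fundamental (t₀ := t) hTc hub hAw hreg ht
  have hone : ∀ t ∈ T, TimeScale.transitionMatrix T A t t = 1 := fun t ht =>
    (TimeScale.transitionMatrix_solves hTc hub hAw hreg ht).1
  refine ⟨TimeScale.exists_solvesTSDLE hTc hub hMw (hfund t₀ ht₀) ht₀ (hone t₀ ht₀) P₀, ?_⟩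
  rintro P hP rfl
  have hlim₀ := TimeScale.tendsto_conj_zero hTc hub hMw (hfund t₀ ht₀).deriv hP ht₀ (hone t₀ ht₀)
    hP₀
  -- Changing the base point from `t₀` to `t` conjugates by the constant matrix `Φ(t, t₀)⁻¹`, which
  -- preserves the limit `0`.
  have hlim : ∀ t ∈ T, Tendsto (fun b => (TimeScale.transitionMatrix T A b t)ᵀ * P b *
      TimeScale.transitionMatrix T A b t) (atTop ⊓ 𝓟 T) (𝓝 0) := fun t ht => by
    have hcont : Continuous fun Q : Matrix (Fin n) (Fin n) ℝ =>
        ((TimeScale.transitionMatrix T A t t₀)⁻¹)ᵀ * Q *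
          (TimeScale.transitionMatrix T A t t₀)⁻¹ := by fun_prop
    have h := (hcont.tendsto 0).comp hlim₀
    rw [mul_zero, zero_mul] at h
    refine h.congr' ?_
    filter_upwards [mem_inf_of_right (mem_principal_self T)] with b hb
    rw [TimeScale.transitionMatrix_eq_mul_inv hTc hub hAw hreg ht₀ hb ht, Matrix.transpose_mul]
    simp only [Function.comp, mul_assoc]
  -- The explicit formula holds for an arbitrary solution, so it also carries uniqueness on `T`.
  refine ⟨fun t ht => ?_, fun t ht => ?_, fun hMpos => ?_⟩
  · have h := hP.conj_eq hTc hub hMw (hfund t₀ ht₀).deriv ht₀ ht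
    rw [hone t₀ ht₀, Matrix.transpose_one, one_mul, mul_one] at h
    rw [← sub_mul, ← mul_sub, ← h, TimeScale.inv_conj_cancel ((hfund t₀ ht₀).isUnit t ht)]
  · exact TimeScale.hasImproperDeltaIntegral_of_tendsto hTc hub hMw (hfund t ht).deriv hP ht
      (hone t ht) (hlim t ht)
  · have hpos : ∀ t ∈ T, (P t).PosDef := fun t ht =>
      TimeScale.posDef_of_tendsto hTc hub (hfund t ht) hP hMpos ht (hone t ht) (hlim t ht)
    refine ⟨hpos, TimeScale.isLyapunovFunction_quadForm hP hMpos hpos, fun x hx t ht hxt => ?_⟩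
    refine ⟨_, hP.hasDeltaDerivAt_quadForm ht (hx t ht), ?_⟩
    have := (hMpos t ht).dotProduct_mulVec_pos hxt
    rw [star_trivial] at this
    linarith
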